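/- Let $d\ge 0$, let $\lambda,N>0$ be real, let $E_1,\dots,E_d>0$ be pairwise distinct and $r_1,\dots,r_d>0$ real (in the matrix model the $r_k$ are the multiplicities of the $E_k$ and $N=\sum_k r_k$). Let $\varepsilon_k,\varrho_k>0$ $(k=1,\dots,d)$ solve $$E_k=R(\varepsilon_k),\qquad r_k=\varrho_k R'(\varepsilon_k),\qquad R(z):=z-\frac{\lambda}{N}\sum_{j=1}^d\frac{\varrho_j}{\varepsilon_j+z},$$ and let $\alpha_1,\dots,\alpha_d>0$ be the pairwise distinct positive roots of the rational function $R(z)-R(-z)$. Let $V\subset\{\mathrm{Re}\,z>0\}$ be an open set that contains $(0,\infty)$ and on which $R$ is injective. For $w\in V$ let $\hat w^1,\dots,\hat w^d$ be the other preimages of $R(w)$, so that $R^{-1}(R(w))=\{w,\hat w^1,\dots,\hat w^d\}$ with multiplicity, and let $$\mathcal G^{(0)}(z,w)=\frac{1}{z+w}\prod_{k,l=1}^d\frac{(\varepsilon_k+\varepsilon_l)(-\hat w^k-\hat z^l)}{(\varepsilon_k-\hat z^l)(\varepsilon_l-\hat w^k)} \;=\;\frac{1}{R(w)-R(-z)}\prod_{j=1}^d\frac{R(z)-R(-\hat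 w^j)}{R(z)-R(\varepsilon_j)}$$ be the planar two-point function on $V\times V$ (defined by the first expression; the second one agrees with it wherever no denominator vanishes). Consider functions $\mathcal G^{(0)}(\cdot|\cdot)$ on $V\times V$ that are holomorphic in the first variable (in particular regular at $z=\alpha_k$) and satisfy the affine equation of the planar $1+1$-point function $$\big(R(z)-R(-z)\big)\mathcal G^{(0)}(z|w)-\frac{\lambda}{N}\sum_{k=1}^d\frac{r_k\,\mathcal G^{(0)}(\varepsilon_k|w)}{R(\varepsilon_k)-R(z)}=\lambda\,\frac{\mathcal G^{(0)}(z,w)-\mathcal G^{(0)}(w,w)}{R(z)-R(w)}$$ for all $z,w\in V$ with $z\ne w$ and $z\notin\{\varepsilon_1,\dots,\varepsilon_d\}$. Then such a function exists, and every such function is symmetric, $\mathcal G^{(0)}(z|w)=\mathcal G^{(0)}(w|z)$ for all $z,w\in V$, and is given by $$\mathcal G^{(0)}(z|w)=\frac{\lambda}{(R(z)-R(w))^2}\Big(\mathcal G^{(0)}(z,w)-\frac{R(z)+R(w)-2R(0)}{(R(z)-R(-z))(R(w)-R(-w))}\prod_{k=1}^d\frac{(R(z)-R(\alpha_k))(R(w)-R(\alpha_k))}{(R(z)-R(\varepsilon_k))(R(w)-R(\varepsilon_k))}\Big)$$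 for all $z,w\in V$ with $z\neq w$ and $z,w\notin\{\varepsilon_1,\dots,\varepsilon_d,\alpha_1,\dots,\alpha_d\}$ (the excluded points are removable singularities of the right-hand side). -/

import Mathlib

open scoped Polynomial

namespace QuarticKontsevich

noncomputable section

/-- The rational function `R(z) = z - (lam/N) ∑ₖ ϱₖ / (εₖ + z)`
(a meaningful value for `z ∉ {-ε₁, …, -ε_d}`). -/
def R {d : ℕ} (lam N : ℝ) (ε ϱ : Fin d → ℝ) (z : ℂ) : ℂ :=
  z - (lam / N : ℂ) * ∑ k, (ϱ k : ℂ) / ((ε k : ℂ) + z)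

/-- The numerator `(X - c) ∏ₖ (X + εₖ) - (lam/N) ∑ₖ ϱₖ ∏_{j ≠ k} (X + εⱼ)` of the rational
function `R(X) - c`: a monic polynomial of degree `d + 1` whose roots are the preimages of `c`
under `R`, with multiplicity. -/
def fibrePoly {d : ℕ} (lam N : ℝ) (ε ϱ : Fin d → ℝ) (c : ℂ) : ℂ[X] :=
  (Polynomial.X - Polynomial.C c) * ∏ k, (Polynomial.X + Polynomial.C (ε k : ℂ))
    - Polynomial.C (lam / N : ℂ) *
      ∑ k, Polynomial.C (ϱ k : ℂ) *
        ∏ j ∈ Finset.univ.erase k, (Polynomial.X + Polynomial.C (ε j : ℂ))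

/-- The list `ŵ¹, …, ŵᵈ` of the `d` other preimages of `R(w)` under `R`, so that
`R⁻¹(R(w)) = {w, ŵ¹, …, ŵᵈ}`. -/
def hats {d : ℕ} (lam N : ℝ) (ε ϱ : Fin d → ℝ) (w : ℂ) : Multiset ℂ :=
  (fibrePoly lam N ε ϱ (R lam N ε ϱ w)).roots.erase w

/-- The planar two-point function
`𝒢(z,w) = 1/(z+w) ∏_{k,l} (εₖ+εₗ)(-ŵᵏ-ẑˡ) / ((εₖ-ẑˡ)(εₗ-ŵᵏ))`.
At points where no denominator vanishes it equals
`1/(R(w)-R(-z)) ∏ⱼ (R(z)-R(-ŵʲ))/(R(z)-R(εⱼ))`; the product form is used because it has no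
removable singularity in the region where the two-point function is considered. -/
def twoPoint {d : ℕ} (lam N : ℝ) (ε ϱ : Fin d → ℝ) (z w : ℂ) : ℂ :=
  1 / (z + w) *
    (((∏ k, ∏ l, ((ε k : ℂ) + (ε l : ℂ))) *
        ((hats lam N ε ϱ w).map fun u => ((hats lam N ε ϱ z).map fun v => -u - v).prod).prod) /
      ((∏ k, ((hats lam N ε ϱ z).map fun v => (ε k : ℂ) - v).prod) *
        (∏ l, ((hats lam N ε ϱ w).map fun u => (ε l : ℂ) - u).prod)))

/-- `G(z|w)` is a regular solution on `V × V` of the affine equation of the planar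
`1+1`-point function:
`(R(z)-R(-z)) G(z|w) - (lam/N) ∑ₖ rₖ G(εₖ|w)/(R(εₖ)-R(z))
    = lam (𝒢(z,w) - 𝒢(w,w))/(R(z)-R(w))`.
The equation is imposed wherever its terms are literally defined (`z ≠ w`, `z ≠ εₖ`);
regularity, i.e. holomorphy in `z`, takes care of the remaining points. -/
structure IsOnePlusOnePoint {d : ℕ} (lam N : ℝ) (r ε ϱ : Fin d → ℝ) (V : Set ℂ)
    (G : ℂ → ℂ → ℂ) : Prop where
  regular : ∀ w ∈ V, DifferentiableOn ℂ (fun z => G z w) V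
  equation : ∀ z ∈ V, ∀ w ∈ V, z ≠ w → (∀ k, z ≠ (ε k : ℂ)) →
    (R lam N ε ϱ z - R lam N ε ϱ (-z)) * G z w
      - (lam / N : ℂ) *
        ∑ k, (r k : ℂ) * G (ε k : ℂ) w / (R lam N ε ϱ (ε k : ℂ) - R lam N ε ϱ z)
    = (lam : ℂ) * ((twoPoint lam N ε ϱ z w - twoPoint lam N ε ϱ w w) /
        (R lam N ε ϱ z - R lam N ε ϱ w))

end

end QuarticKontsevich

/-!
A symmetric solution of the affine equation is written down in closed form, and the equation has at
most one regular solution; both claims of the theorem about an arbitrary solution follow.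

*Uniqueness.* The difference `F` of two solutions for the same `w` satisfies
`(R(z) - R(-z)) F(z) = (λ/N) ∑ₖ rₖ F(εₖ) / (R(εₖ) - R(z))`. At `z = αⱼ` the left side vanishes, so
the numbers `rₖ F(εₖ)` solve a homogeneous Cauchy system and are zero; hence `F` vanishes away from
finitely many points, and by continuity everywhere (`Region.eq_zero_of_homogeneous_equation`).

*The candidate.* Write `T(z) = 1/(R(z) - R(-z)) ∏ₖ (R(z) - R(αₖ)) / (R(z) - R(εₖ))`
(`diagFactor`). The candidate is `λ D(z,w) / (R(z) - R(w))²` with the defect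
`D(z,w) = 𝒢(z,w) - (R(z) + R(w) - 2R(0)) T(z) T(w)`. It is regular because `D` has a double zero on
the diagonal: `D` is symmetric and holomorphic in both variables together, since `∏ (-ŵᵏ - ẑˡ)` is a
resultant (`hatProd_eq_resultant`), and it vanishes for `z = w`. The last fact is the diagonal
evaluation `𝒢(w,w) = 2 (R(w) - R(0)) T(w)²` (`Region.twoPoint_self`): for a preimage `u` of `R(w)`
one has `R(w) - R(-u) = R(u) - R(-u)`, whose numerator is `2u ∏ₖ (u² - αₖ²)`, and the product over
all `u` is computed from the values at `0` and `±αₖ` of the polynomial with roots `ŵ¹, …, ŵᵈ`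
(`hatPoly`).

*The equation.* For fixed `w` both `(R(w) - R(-z)) 𝒢(z,w)` and `(R(z) - R(-z)) T(z)` are rational in
`t = R(z)` with denominator `∏ₖ (t - R(εₖ))`. Therefore
`(R(z) - R(-z)) D(z,w) - (R(z) - R(w)) (𝒢(z,w) - 𝒢(w,w))` is such a function, with numerator of
degree at most `d + 1` (`equationNum`). The numerator is divisible by `(t - R(w))²`, so the quotient
by `(t - R(w))²` is a sum of simple fractions in `t`, and its residues at `R(εₖ)` are those
prescribed by the affine equation because `R(-z)` has residue `rₖ λ/N` there
(`Region.eval_residue`). Points where this argument meets a pole are reached by continuity.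

All of this uses that `R'` has no zero in `V`, that is, that the divided difference `dividedR` does
not vanish on `V × V` (`dividedR_ne_zero`).
-/

namespace QuarticKontsevich

open Polynomial Finset

/-! ### Partial fractions with simple poles -/

/-- The numerator `∑ₖ cₖ ∏_{j ≠ k} (X - eⱼ)` of the partial fraction `∑ₖ cₖ / (X - eₖ)`. -/
noncomputable def partialFractionNum {d : ℕ} (e c : Fin d → ℂ) : ℂ[X] :=
  ∑ k, C (c k) * ∏ j ∈ univ.erase k, (X - C (e j))

lemma degree_partialFractionNum_lt {d : ℕ} (e c : Fin d → ℂ) :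
    (partialFractionNum e c).degree < d := by
  refine (degree_sum_le _ _).trans_lt ((Finset.sup_lt_iff (WithBot.bot_lt_coe d)).2 fun k _ => ?_)
  rw [← smul_eq_C_mul]
  refine (degree_smul_le _ _).trans_lt ?_
  rw [degree_prod_of_monic _ _ fun j _ => monic_X_sub_C _]
  simp only [degree_X_sub_C, sum_const, nsmul_eq_mul, mul_one]
  have := card_erase_lt_of_mem (mem_univ k)
  rw [card_univ, Fintype.card_fin] at this
  rw [Nat.cast_withBot]
  exact WithBot.coe_lt_coe.2 this

lemma eval_partialFractionNum_node {d : ℕ} (e c : Fin d → ℂ) (k : Fin d) :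
    (partialFractionNum e c).eval (e k) = c k * ∏ j ∈ univ.erase k, (e k - e j) := by
  rw [partialFractionNum, eval_finsetSum, Finset.sum_eq_single k]
  · simp [eval_prod]
  · intro b _ hb
    rw [eval_mul, eval_prod, Finset.prod_eq_zero (i := k) (by simp [hb.symm]) (by simp), mul_zero]
  · simp

lemma eval_partialFractionNum {d : ℕ} (e c : Fin d → ℂ) {x : ℂ} (hx : ∀ k, x - e k ≠ 0) :
    (partialFractionNum e c).eval x = (∏ k, (x - e k)) * ∑ k, c k / (x - e k) := by
  rw [partialFractionNum, eval_finsetSum, Finset.mul_sum]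
  refine Finset.sum_congr rfl fun k _ => ?_
  rw [← Finset.mul_prod_erase univ _ (mem_univ k)]
  simp only [eval_mul, eval_C, eval_prod, eval_sub, eval_X]
  field_simp [hx k]

lemma prod_node_sub_ne_zero {d : ℕ} {e : Fin d → ℂ} (he : Function.Injective e) (k : Fin d) :
    ∏ j ∈ univ.erase k, (e k - e j) ≠ 0 :=
  Finset.prod_ne_zero_iff.2 fun _ hj => sub_ne_zero.2 fun h => (mem_erase.1 hj).1 (he h).symm

lemma eq_of_eval_eq_of_degree_lt {d : ℕ} {e : Fin d → ℂ} (he : Function.Injective e) {p q : ℂ[X]}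
    (hp : p.degree < d) (hq : q.degree < d) (h : ∀ k, p.eval (e k) = q.eval (e k)) : p = q :=
  eq_of_degrees_lt_of_eval_index_eq (s := univ) (v := e) he.injOn (by simpa using hp)
    (by simpa using hq) fun k _ => h k

/-- Invertibility of the Cauchy matrix `1 / (aⱼ - eₖ)`. -/
lemma eq_zero_of_sum_div_eq_zero {d : ℕ} {e a c : Fin d → ℂ} (he : Function.Injective e)
    (ha : Function.Injective a) (hae : ∀ j k, a j - e k ≠ 0)
    (h : ∀ j, ∑ k, c k / (a j - e k) = 0) (k : Fin d) : c k = 0 := by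
  have h0 : partialFractionNum e c = 0 :=
    eq_of_eval_eq_of_degree_lt ha (degree_partialFractionNum_lt e c) (by simp)
      fun j => by rw [eval_partialFractionNum e c (hae j), h j]; simp
  have := eval_partialFractionNum_node e c k
  rw [h0, eval_zero] at this
  exact (mul_eq_zero.1 this.symm).resolve_right (prod_node_sub_ne_zero he k)

lemma monic_prod_add_partialFractionNum {d : ℕ} (e c : Fin d → ℂ) :
    (∏ k, (X - C (e k)) + partialFractionNum e c).Monic := by
  refine (monic_prod_of_monic _ _ fun k _ => monic_X_sub_C _).add_of_left ?_
  rw [degree_prod_of_monic _ _ fun j _ => monic_X_sub_C _]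
  simpa using degree_partialFractionNum_lt e c

lemma natDegree_prod_add_partialFractionNum {d : ℕ} (e c : Fin d → ℂ) :
    (∏ k, (X - C (e k)) + partialFractionNum e c).natDegree = d := by
  have h : (∏ k, (X - C (e k))).degree = (d : WithBot ℕ) := by
    rw [degree_prod_of_monic _ _ fun j _ => monic_X_sub_C _]
    simp
  refine natDegree_eq_of_degree_eq_some ?_
  rw [degree_add_eq_left_of_degree_lt, h]
  rw [h]
  exact degree_partialFractionNum_lt e c

/-! ### The rational function `R` and its divided difference -/

variable {d : ℕ} (lam N : ℝ) (ε ϱ : Fin d → ℝ)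

/-- The divided difference `(R(z) - R(w)) / (z - w)`, whose restriction to the diagonal is `R'`. -/
noncomputable def dividedR (z w : ℂ) : ℂ :=
  1 + (lam / N : ℂ) * ∑ k, (ϱ k : ℂ) / (((ε k : ℂ) + z) * ((ε k : ℂ) + w))

local notation "ℛ" => R lam N ε ϱ
local notation "𝒦" => dividedR lam N ε ϱ

lemma dividedR_comm (z w : ℂ) : 𝒦 z w = 𝒦 w z := by
  simp only [dividedR, mul_comm]

variable {ε} in
lemma add_ne_zero_of_re_pos (hε : ∀ k, 0 < ε k) {z : ℂ} (hz : 0 < z.re) (k : Fin d) :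
    (ε k : ℂ) + z ≠ 0 := by
  intro h
  have := congrArg Complex.re h
  simp only [Complex.add_re, Complex.ofReal_re, Complex.zero_re] at this
  linarith [hε k]

variable {ε} in
lemma R_sub_R {z w : ℂ} (hz : ∀ k, (ε k : ℂ) + z ≠ 0) (hw : ∀ k, (ε k : ℂ) + w ≠ 0) :
    ℛ z - ℛ w = (z - w) * 𝒦 z w := by
  have h : ∀ k, (ϱ k : ℂ) / (((ε k : ℂ) + z) * ((ε k : ℂ) + w)) * (z - w)
      = (ϱ k : ℂ) / ((ε k : ℂ) + w) - (ϱ k : ℂ) / ((ε k : ℂ) + z) := fun k => by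
    have := hz k
    have := hw k
    field_simp
    ring
  have h2 : (∑ k, (ϱ k : ℂ) / (((ε k : ℂ) + z) * ((ε k : ℂ) + w))) * (z - w)
      = ∑ k, (ϱ k : ℂ) / ((ε k : ℂ) + w) - ∑ k, (ϱ k : ℂ) / ((ε k : ℂ) + z) := by
    rw [Finset.sum_mul, ← Finset.sum_sub_distrib]
    exact Finset.sum_congr rfl fun k _ => h k
  rw [R, R, dividedR]
  linear_combination -(lam / N : ℂ) * h2

/-- The monic polynomial of degree `d` whose roots are the preimages `ẑ¹, …, ẑᵈ` of `R(z)` other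
than `z`; it is the numerator of `x ↦ (R(x) - R(z)) / (x - z)`. -/
noncomputable def hatPoly (z : ℂ) : ℂ[X] :=
  ∏ k, (X - C (-(ε k : ℂ))) +
    partialFractionNum (fun k => -(ε k : ℂ)) fun k => (lam / N : ℂ) * ϱ k / ((ε k : ℂ) + z)

local notation "𝒬" => hatPoly lam N ε ϱ

lemma hatPoly_monic (z : ℂ) : (𝒬 z).Monic := monic_prod_add_partialFractionNum _ _

lemma natDegree_hatPoly (z : ℂ) : (𝒬 z).natDegree = d := natDegree_prod_add_partialFractionNum _ _

variable {ε} in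
lemma eval_hatPoly {x : ℂ} (hx : ∀ k, (ε k : ℂ) + x ≠ 0) (z : ℂ) :
    (𝒬 z).eval x = (∏ k, ((ε k : ℂ) + x)) * 𝒦 x z := by
  rw [hatPoly, eval_add, eval_partialFractionNum _ _ fun k => by simpa [add_comm] using hx k,
    eval_prod, dividedR, mul_add, Finset.mul_sum univ _ (lam / N : ℂ)]
  simp only [eval_sub, eval_X, eval_C, sub_neg_eq_add, add_comm x, mul_one]
  congr 2
  refine Finset.sum_congr rfl fun k _ => ?_
  rw [div_div, mul_div_assoc, mul_comm ((ε k : ℂ) + z)]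

lemma eval_hatPoly_neg_node (z : ℂ) (k : Fin d) :
    (𝒬 z).eval (-(ε k : ℂ)) = (lam / N : ℂ) * ϱ k / ((ε k : ℂ) + z) *
      ∏ j ∈ univ.erase k, ((ε j : ℂ) - ε k) := by
  have := eval_partialFractionNum_node (fun k => -(ε k : ℂ))
    (fun k => (lam / N : ℂ) * ϱ k / ((ε k : ℂ) + z)) k
  rw [hatPoly, eval_add, this, eval_prod, Finset.prod_eq_zero (mem_univ k) (by simp), zero_add]
  congr 1
  exact Finset.prod_congr rfl fun j _ => by ring

variable {ε} in
/-- The preimage `w` of `R(w)` splits off the fibre polynomial as a linear factor. -/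
lemma fibrePoly_R {w : ℂ} (hw : ∀ k, (ε k : ℂ) + w ≠ 0) :
    fibrePoly lam N ε ϱ (ℛ w) = (X - C w) * 𝒬 w := by
  have hterm : ∀ k, (X - C w) * (C ((lam / N : ℂ) * ϱ k / ((ε k : ℂ) + w)) *
        ∏ j ∈ univ.erase k, (X + C (ε j : ℂ)))
      = C ((lam / N : ℂ) * (ϱ k / ((ε k : ℂ) + w))) * ∏ j, (X + C (ε j : ℂ))
        - C (lam / N : ℂ) * (C (ϱ k : ℂ) * ∏ j ∈ univ.erase k, (X + C (ε j : ℂ))) := by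
    intro k
    rw [← Finset.mul_prod_erase univ _ (mem_univ k)]
    have h1 : (C ((lam / N : ℂ) * (ϱ k / ((ε k : ℂ) + w))) : ℂ[X]) * (C (ε k : ℂ) + C w)
        = C (lam / N : ℂ) * C (ϱ k : ℂ) := by
      rw [← C_add, ← C_mul, ← C_mul]
      congr 1
      field_simp [hw k]
    rw [mul_div_assoc]
    linear_combination (-∏ j ∈ univ.erase k, (X + C (ε j : ℂ))) * h1
  rw [hatPoly, partialFractionNum, mul_add, Finset.mul_sum]
  simp only [map_neg, sub_neg_eq_add]
  rw [Finset.sum_congr rfl fun k _ => hterm k, Finset.sum_sub_distrib, ← Finset.sum_mul,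
    ← Finset.mul_sum, ← map_sum, ← Finset.mul_sum, fibrePoly, R, C_sub]
  ring

variable {ε} in
lemma hats_eq_roots {w : ℂ} (hw : ∀ k, (ε k : ℂ) + w ≠ 0) :
    hats lam N ε ϱ w = (𝒬 w).roots := by
  rw [hats, fibrePoly_R lam N ϱ hw,
    roots_mul (mul_ne_zero (X_sub_C_ne_zero w) (hatPoly_monic lam N ε ϱ w).ne_zero),
    roots_X_sub_C]
  simp

lemma card_roots_hatPoly (z : ℂ) : Multiset.card (𝒬 z).roots = d := by
  rw [← (IsAlgClosed.splits (𝒬 z)).natDegree_eq_card_roots, natDegree_hatPoly]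

lemma prod_sub_roots_hatPoly (z x : ℂ) :
    ((𝒬 z).roots.map fun u => x - u).prod = (𝒬 z).eval x := by
  rw [(IsAlgClosed.splits (𝒬 z)).eval_eq_prod_roots_of_monic (hatPoly_monic lam N ε ϱ z)]

/-- The product `∏_{k,l} (-ŵᵏ - ẑˡ)`, with the product over `l` written as a value of the
polynomial with roots `ẑ¹, …, ẑᵈ`. -/
noncomputable def hatProd (z w : ℂ) : ℂ := ((𝒬 w).roots.map fun u => (𝒬 z).eval (-u)).prod

local notation "𝒮" => hatProd lam N ε ϱ

lemma hatProd_eq (z w : ℂ) :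
    𝒮 z w = ((𝒬 w).roots.map fun u => ((𝒬 z).roots.map fun v => -u - v).prod).prod := by
  simp only [hatProd, prod_sub_roots_hatPoly]

lemma hatProd_comm (z w : ℂ) : 𝒮 z w = 𝒮 w z := by
  rw [hatProd_eq, hatProd_eq, Multiset.prod_map_prod_map]
  simp only [neg_sub_left, add_comm]

/-- As a resultant, the product `∏_{k,l} (-ŵᵏ - ẑˡ)` is a polynomial in the coefficients of the
two polynomials, hence holomorphic in `(z, w)` although the individual roots need not be. -/
lemma hatProd_eq_resultant (z w : ℂ) :
    𝒮 z w = resultant (𝒬 w) ((𝒬 z).comp (-X)) d d := by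
  have h := resultant_eq_prod_eval (𝒬 w) ((𝒬 z).comp (-X)) d
    (by rw [natDegree_comp]; simp [natDegree_hatPoly]) (IsAlgClosed.splits _)
  rw [natDegree_hatPoly, (hatPoly_monic lam N ε ϱ w).leadingCoeff, one_pow, one_mul] at h
  simpa [hatProd] using h.symm

variable {ε} in
lemma twoPoint_eq {z w : ℂ} (hz : ∀ k, (ε k : ℂ) + z ≠ 0) (hw : ∀ k, (ε k : ℂ) + w ≠ 0) :
    twoPoint lam N ε ϱ z w = 1 / (z + w) * ((∏ k, ∏ l, ((ε k : ℂ) + (ε l : ℂ))) * 𝒮 z w /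
      ((∏ k, (𝒬 z).eval (ε k : ℂ)) * ∏ k, (𝒬 w).eval (ε k : ℂ))) := by
  rw [twoPoint, hats_eq_roots lam N ϱ hz, hats_eq_roots lam N ϱ hw, hatProd_eq]
  simp only [prod_sub_roots_hatPoly]

variable (α : Fin d → ℝ)

/-! ### Parameters and regions -/

/-- The parameters `λ`, `N`, `εₖ`, `ϱₖ` together with the positive roots `αₖ` of
`R(z) - R(-z)`. -/
structure Parameters : Prop where
  lam_pos : 0 < lam
  N_pos : 0 < N
  ε_pos : ∀ k, 0 < ε k
  ε_injective : Function.Injective ε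
  ϱ_pos : ∀ k, 0 < ϱ k
  α_pos : ∀ k, 0 < α k
  α_injective : Function.Injective α
  α_ne_ε : ∀ k j, α k ≠ ε j
  R_α : ∀ k, ℛ (α k : ℂ) = ℛ (-(α k : ℂ))

/-- An open subset of the right half plane that contains `(0, ∞)` and on which `R` is
injective. -/
structure Region (V : Set ℂ) : Prop where
  isOpen : IsOpen V
  ofReal_mem : ∀ x : ℝ, 0 < x → (x : ℂ) ∈ V
  re_pos : ∀ z ∈ V, 0 < z.re
  injOn : Set.InjOn ℛ V

variable {lam N ε ϱ α} {V : Set ℂ}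

namespace Parameters

variable (p : Parameters lam N ε ϱ α)
include p

lemma coupling_ne_zero : (lam / N : ℂ) ≠ 0 :=
  div_ne_zero (Complex.ofReal_ne_zero.2 p.lam_pos.ne') (Complex.ofReal_ne_zero.2 p.N_pos.ne')

lemma ε_re_pos (k : Fin d) : 0 < (ε k : ℂ).re := by simpa using p.ε_pos k

lemma α_re_pos (k : Fin d) : 0 < (α k : ℂ).re := by simpa using p.α_pos k

lemma add_ne_zero {z : ℂ} (hz : 0 < z.re) (k : Fin d) : (ε k : ℂ) + z ≠ 0 :=
  add_ne_zero_of_re_pos p.ε_pos hz k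

lemma α_add_ne_zero {z : ℂ} (hz : 0 < z.re) (k : Fin d) : (α k : ℂ) + z ≠ 0 :=
  add_ne_zero_of_re_pos p.α_pos hz k

end Parameters

/-! ### Holomorphy -/

lemma differentiableAt_dividedR {z w : ℂ} (hz : ∀ k, (ε k : ℂ) + z ≠ 0)
    (hw : ∀ k, (ε k : ℂ) + w ≠ 0) :
    DifferentiableAt ℂ (fun q : ℂ × ℂ => 𝒦 q.1 q.2) (z, w) := by
  unfold dividedR
  refine (differentiableAt_const _).add ((differentiableAt_const _).mul ?_)
  refine DifferentiableAt.fun_sum fun k _ => ?_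
  have h : DifferentiableAt ℂ
      (fun q : ℂ × ℂ => ((ε k : ℂ) + q.1) * ((ε k : ℂ) + q.2)) (z, w) := by fun_prop
  simp only [div_eq_mul_inv]
  exact (differentiableAt_const _).mul (h.inv (mul_ne_zero (hz k) (hw k)))

lemma differentiableAt_R {z : ℂ} (hz : ∀ k, (ε k : ℂ) + z ≠ 0) : DifferentiableAt ℂ ℛ z := by
  have h : ℛ = fun z => z - (lam / N : ℂ) * ∑ k, (ϱ k : ℂ) / ((ε k : ℂ) + z) := rfl
  rw [h]
  refine differentiableAt_id.sub ((differentiableAt_const _).mul ?_)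
  refine DifferentiableAt.fun_sum fun k _ => ?_
  refine (differentiableAt_const _).div ?_ (hz k)
  fun_prop

lemma differentiableAt_coeff_hatPoly {z : ℂ} (hz : ∀ k, (ε k : ℂ) + z ≠ 0) (i : ℕ) :
    DifferentiableAt ℂ (fun z => (𝒬 z).coeff i) z := by
  simp only [hatPoly, partialFractionNum, coeff_add, finsetSum_coeff, coeff_C_mul]
  refine (differentiableAt_const _).add (DifferentiableAt.fun_sum fun k _ => ?_)
  refine DifferentiableAt.mul ((differentiableAt_const _).div ?_ (hz k)) (differentiableAt_const _)
  fun_prop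

lemma differentiableAt_finset_prod {E ι : Type*} [NormedAddCommGroup E] [NormedSpace ℂ E]
    {s : Finset ι} {f : ι → E → ℂ} {x : E} (h : ∀ i ∈ s, DifferentiableAt ℂ (f i) x) :
    DifferentiableAt ℂ (fun y => ∏ i ∈ s, f i y) x := by
  classical exact (HasFDerivAt.finsetProd fun i hi => (h i hi).hasFDerivAt).differentiableAt

lemma differentiableAt_resultant {E : Type*} [NormedAddCommGroup E] [NormedSpace ℂ E]
    {f g : E → ℂ[X]} {m n : ℕ} {x : E} (hf : ∀ i, DifferentiableAt ℂ (fun y => (f y).coeff i) x)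
    (hg : ∀ i, DifferentiableAt ℂ (fun y => (g y).coeff i) x) :
    DifferentiableAt ℂ (fun y => resultant (f y) (g y) m n) x := by
  simp only [resultant, Matrix.det_apply']
  refine DifferentiableAt.fun_sum fun σ _ => (differentiableAt_const _).mul ?_
  refine differentiableAt_finset_prod
    (f := fun i y => sylvester (f y) (g y) m n (σ i) i) fun i _ => ?_
  induction i using Fin.addCases with
  | left i =>
    simp only [sylvester, Matrix.of_apply, Fin.addCases_left]
    split_ifs
    exacts [hg _, differentiableAt_const _]
  | right i =>
    simp only [sylvester, Matrix.of_apply, Fin.addCases_right]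
    split_ifs
    exacts [hf _, differentiableAt_const _]

lemma differentiableAt_hatProd {z w : ℂ} (hz : ∀ k, (ε k : ℂ) + z ≠ 0)
    (hw : ∀ k, (ε k : ℂ) + w ≠ 0) :
    DifferentiableAt ℂ (fun q : ℂ × ℂ => 𝒮 q.1 q.2) (z, w) := by
  simp only [hatProd_eq_resultant]
  refine differentiableAt_resultant (fun i => ?_) fun i => ?_
  · exact DifferentiableAt.fun_comp' (f := Prod.snd) (z, w) (differentiableAt_coeff_hatPoly hw i)
      differentiableAt_snd
  · have h : ∀ p : ℂ[X], (p.comp (-X)).coeff i = p.coeff i * (-1) ^ i := fun p => by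
      simpa using comp_C_mul_X_coeff (p := p) (r := -1) (n := i)
    simp only [h]
    exact (DifferentiableAt.fun_comp' (f := Prod.fst) (z, w) (differentiableAt_coeff_hatPoly hz i)
      differentiableAt_fst).mul (differentiableAt_const _)

/-! ### The divided difference has no zero in `V × V` -/

lemma pow_card_le_norm_prod (s : Multiset ℂ) {δ : ℝ} (hδ : 0 ≤ δ) (h : ∀ u ∈ s, δ ≤ ‖u‖) :
    δ ^ Multiset.card s ≤ ‖s.prod‖ := by
  induction s using Multiset.induction with
  | empty => simp
  | cons a s ih =>
    rw [Multiset.card_cons, Multiset.prod_cons, norm_mul, pow_succ']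
    exact mul_le_mul (h a (by simp)) (ih fun u hu => h u (by simp [hu])) (by positivity)
      (norm_nonneg _)

/-- At positive real arguments the divided difference is at least `1`. -/
lemma dividedR_one_ne_zero (p : Parameters lam N ε ϱ α) : 𝒦 1 1 ≠ 0 := by
  have h : 𝒦 1 1 = ((1 + lam / N * ∑ k, ϱ k / ((ε k + 1) * (ε k + 1)) : ℝ) : ℂ) := by
    simp [dividedR]
  rw [h, Complex.ofReal_ne_zero]
  have h1 : 0 ≤ lam / N := (div_pos p.lam_pos p.N_pos).le
  have h2 : 0 ≤ ∑ k, ϱ k / ((ε k + 1) * (ε k + 1)) := Finset.sum_nonneg fun k _ => by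
    have := p.ϱ_pos k
    have := p.ε_pos k
    positivity
  positivity

/-- A zero of `R'` in `V` would make two preimages of `R(z)` collide there; by injectivity every
nearby point would then be a zero of `R'` as well, against the identity theorem. -/
lemma dividedR_self_ne_zero (p : Parameters lam N ε ϱ α) (hV : Region lam N ε ϱ V) {w : ℂ}
    (hw : w ∈ V) : 𝒦 w w ≠ 0 := by
  intro h0
  have hwε := p.add_ne_zero (hV.re_pos w hw)
  obtain ⟨δ, hδ, hball⟩ := Metric.isOpen_iff.1 hV.isOpen w hw
  have hev : ∀ᶠ z in nhds w, 𝒦 z z = 0 := by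
    have hcont : ContinuousAt (fun z => (𝒬 z).eval w) w := by
      simp only [eval_hatPoly lam N ϱ hwε]
      have h1 : ContinuousAt (fun z => 𝒦 w z) w :=
        (differentiableAt_dividedR hwε hwε).continuousAt.comp
          (f := fun z => (w, z)) (continuousAt_const.prodMk continuousAt_id)
      exact continuousAt_const.mul h1
    have hlt : ∀ᶠ z in nhds w, ‖(𝒬 z).eval w‖ < δ ^ d := by
      refine hcont.norm.eventually_lt continuousAt_const ?_
      rw [eval_hatPoly lam N ϱ hwε, h0, mul_zero, norm_zero]
      positivity
    filter_upwards [hlt, hV.isOpen.mem_nhds hw] with z hz hzV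
    -- the monic polynomial `𝒬 z` takes a value below `δ ^ d` at `w`, so a root is closer than `δ`
    obtain ⟨u, hu, huw⟩ : ∃ u ∈ (𝒬 z).roots, ‖w - u‖ < δ := by
      by_contra! hcon
      have := pow_card_le_norm_prod ((𝒬 z).roots.map fun u => w - u) hδ.le fun x hx => by
        obtain ⟨u, hu, rfl⟩ := Multiset.mem_map.1 hx
        exact hcon u hu
      rw [prod_sub_roots_hatPoly, Multiset.card_map, card_roots_hatPoly] at this
      exact absurd hz (not_lt.2 this)
    have huV : u ∈ V := hball (by rwa [Metric.mem_ball, dist_comm, dist_eq_norm])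
    have huε := p.add_ne_zero (hV.re_pos u huV)
    have hroot : (𝒬 z).eval u = 0 := (mem_roots'.1 hu).2
    rw [eval_hatPoly lam N ϱ huε] at hroot
    have hK := (mul_eq_zero.1 hroot).resolve_left (Finset.prod_ne_zero_iff.2 fun k _ => huε k)
    have huz : u = z := hV.injOn huV hzV (sub_eq_zero.1 (by
      rw [R_sub_R lam N ϱ huε (p.add_ne_zero (hV.re_pos z hzV)), hK, mul_zero]))
    rwa [huz] at hK
  have hU : IsOpen {z : ℂ | 0 < z.re} := isOpen_lt continuous_const Complex.continuous_re
  have han : AnalyticOnNhd ℂ (fun z => 𝒦 z z) {z : ℂ | 0 < z.re} := by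
    refine DifferentiableOn.analyticOnNhd (fun z hz => ?_) hU
    have hzε := p.add_ne_zero hz
    exact ((differentiableAt_dividedR hzε hzε).comp z (f := fun z => (z, z))
      (differentiableAt_id.prodMk differentiableAt_id)).differentiableWithinAt
  have := han.eqOn_zero_of_preconnected_of_eventuallyEq_zero
    (convex_halfSpace_re_gt 0).isPreconnected (hV.re_pos w hw) hev
  exact dividedR_one_ne_zero p (this (show (1 : ℂ) ∈ {z : ℂ | 0 < z.re} by simp))

lemma dividedR_ne_zero (p : Parameters lam N ε ϱ α) (hV : Region lam N ε ϱ V) {z w : ℂ}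
    (hz : z ∈ V) (hw : w ∈ V) : 𝒦 z w ≠ 0 := by
  rcases eq_or_ne z w with rfl | hzw
  · exact dividedR_self_ne_zero p hV hz
  · intro h
    refine hzw (hV.injOn hz hw (sub_eq_zero.1 ?_))
    rw [R_sub_R lam N ϱ (p.add_ne_zero (hV.re_pos z hz)) (p.add_ne_zero (hV.re_pos w hw)), h,
      mul_zero]

/-! ### The zeros of `R(z) - R(-z)` -/

/-- The polynomial `∏ₖ (X - εₖ²) - (λ/N) ∑ₖ ϱₖ ∏_{j ≠ k} (X - εⱼ²)`, whose value at `z²` is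
`∏ₖ (z² - εₖ²)` times `(R(z) - R(-z)) / (2z)`. -/
noncomputable def oddPoly (lam N : ℝ) (ε ϱ : Fin d → ℝ) : ℂ[X] :=
  ∏ k, (X - C ((ε k : ℂ) ^ 2)) +
    partialFractionNum (fun k => (ε k : ℂ) ^ 2) fun k => -((lam / N : ℂ) * ϱ k)

lemma eval_oddPoly {x : ℂ} (hx : ∀ k, (ε k : ℂ) + x ≠ 0) (hx' : ∀ k, (ε k : ℂ) + -x ≠ 0) :
    (oddPoly lam N ε ϱ).eval (x ^ 2) = (∏ k, (x ^ 2 - (ε k : ℂ) ^ 2)) * 𝒦 x (-x) := by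
  have h : ∀ k, x ^ 2 - (ε k : ℂ) ^ 2 ≠ 0 := fun k => by
    rw [show x ^ 2 - (ε k : ℂ) ^ 2 = -(((ε k : ℂ) + x) * ((ε k : ℂ) + -x)) by ring]
    exact neg_ne_zero.2 (mul_ne_zero (hx k) (hx' k))
  rw [oddPoly, eval_add, eval_partialFractionNum _ _ h, eval_prod, dividedR, mul_add,
    Finset.mul_sum univ _ (lam / N : ℂ)]
  simp only [eval_sub, eval_X, eval_C, mul_one]
  congr 2
  refine Finset.sum_congr rfl fun k _ => ?_
  rw [show x ^ 2 - (ε k : ℂ) ^ 2 = -(((ε k : ℂ) + x) * ((ε k : ℂ) + -x)) by ring, neg_div_neg_eq,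
    mul_div_assoc]

lemma eval_oddPoly_node (k : Fin d) :
    (oddPoly lam N ε ϱ).eval ((ε k : ℂ) ^ 2) = -((lam / N : ℂ) * ϱ k) *
      ∏ j ∈ univ.erase k, ((ε k : ℂ) ^ 2 - (ε j : ℂ) ^ 2) := by
  have := eval_partialFractionNum_node (fun k => (ε k : ℂ) ^ 2)
    (fun k => -((lam / N : ℂ) * ϱ k)) k
  rw [oddPoly, eval_add, this, eval_prod, Finset.prod_eq_zero (mem_univ k) (by simp), zero_add]

lemma ofReal_ne_neg_of_pos {a b : ℝ} (h : a ≠ b) : (b : ℂ) + -(a : ℂ) ≠ 0 := by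
  rw [← sub_eq_add_neg, sub_ne_zero]
  exact fun h' => h (Complex.ofReal_injective h').symm

lemma sq_ofReal_injective {a : Fin d → ℝ} (ha : ∀ k, 0 < a k) (h : Function.Injective a) :
    Function.Injective fun k => (a k : ℂ) ^ 2 := by
  intro i j hij
  have h1 : a i ^ 2 = a j ^ 2 := by
    dsimp only at hij
    exact_mod_cast hij
  exact h ((sq_eq_sq₀ (ha i).le (ha j).le).1 h1)

/-- A monic polynomial of degree `d` is determined by its `d` distinct zeros `αₖ²`. -/
lemma oddPoly_eq_prod (p : Parameters lam N ε ϱ α) :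
    oddPoly lam N ε ϱ = ∏ k, (X - C ((α k : ℂ) ^ 2)) := by
  have h1 : (oddPoly lam N ε ϱ).Monic := monic_prod_add_partialFractionNum _ _
  have h2 : (∏ k, (X - C ((α k : ℂ) ^ 2))).Monic := monic_prod_of_monic _ _ fun k _ =>
    monic_X_sub_C _
  have hd1 : (oddPoly lam N ε ϱ).degree = d := by
    rw [degree_eq_natDegree h1.ne_zero]
    exact congrArg _ (natDegree_prod_add_partialFractionNum _ _)
  have hd2 : (∏ k, (X - C ((α k : ℂ) ^ 2))).degree = (d : WithBot ℕ) := by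
    rw [degree_prod_of_monic _ _ fun j _ => monic_X_sub_C _,
      Finset.sum_congr rfl fun k _ => degree_X_sub_C _]
    simp
  refine eq_of_degree_le_of_eval_index_eq (s := univ) (v := fun k => (α k : ℂ) ^ 2)
    (sq_ofReal_injective p.α_pos p.α_injective).injOn (by simp [hd1]) (hd1.trans hd2.symm)
    (h1.leadingCoeff.trans h2.leadingCoeff.symm) fun k _ => ?_
  have hp := p.add_ne_zero (p.α_re_pos k)
  have hm : ∀ j, (ε j : ℂ) + -(α k : ℂ) ≠ 0 := fun j => ofReal_ne_neg_of_pos (p.α_ne_ε k j)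
  have hR := R_sub_R (ε := ε) lam N ϱ hp hm
  rw [p.R_α k, sub_self] at hR
  have hα : (α k : ℂ) - -(α k : ℂ) ≠ 0 := by
    rw [sub_neg_eq_add, ← two_mul]
    exact mul_ne_zero two_ne_zero (Complex.ofReal_ne_zero.2 (p.α_pos k).ne')
  rw [eval_oddPoly hp hm, (mul_eq_zero.1 hR.symm).resolve_left hα, mul_zero, eval_prod,
    Finset.prod_eq_zero (mem_univ k) (by simp)]

lemma eval_oddPoly_eq_prod (p : Parameters lam N ε ϱ α) (x : ℂ) :
    (oddPoly lam N ε ϱ).eval x = ∏ k, (x - (α k : ℂ) ^ 2) := by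
  simp [oddPoly_eq_prod p, eval_prod]

lemma prod_sq_sub_sq_mul_dividedR (p : Parameters lam N ε ϱ α) {x : ℂ}
    (hx : ∀ k, (ε k : ℂ) + x ≠ 0) (hx' : ∀ k, (ε k : ℂ) + -x ≠ 0) :
    (∏ k, (x ^ 2 - (ε k : ℂ) ^ 2)) * 𝒦 x (-x) = ∏ k, (x ^ 2 - (α k : ℂ) ^ 2) := by
  rw [← eval_oddPoly hx hx', eval_oddPoly_eq_prod p]

/-! ### The two-point function on the diagonal -/

lemma neg_one_pow_mul_self (n : ℕ) : ((-1 : ℂ) ^ n) * (-1) ^ n = 1 := by rw [← mul_pow]; simp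

lemma prod_add_roots_hatPoly (z x : ℂ) :
    ((𝒬 z).roots.map fun u => u + x).prod = (-1) ^ d * (𝒬 z).eval (-x) := by
  have h := Multiset.prod_map_neg ((𝒬 z).roots.map fun u => -x - u)
  rw [Multiset.card_map, card_roots_hatPoly, prod_sub_roots_hatPoly, Multiset.map_map] at h
  simpa [Function.comp_def] using h

lemma multiset_prod_map_finset_prod {ι : Type*} (s : Multiset ℂ) (t : Finset ι) (f : ι → ℂ → ℂ) :
    (s.map fun u => ∏ k ∈ t, f k u).prod = ∏ k ∈ t, (s.map (f k)).prod := by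
  induction s using Multiset.induction with
  | empty => simp
  | cons a s ih => simp [ih, Finset.prod_mul_distrib]

lemma root_hatPoly_ne_neg_node (p : Parameters lam N ε ϱ α) {w : ℂ} (hw : 0 < w.re) {u : ℂ}
    (hu : u ∈ (𝒬 w).roots) (k : Fin d) : (ε k : ℂ) + u ≠ 0 := by
  intro h
  have hroot : (𝒬 w).eval u = 0 := (mem_roots'.1 hu).2
  rw [eq_neg_of_add_eq_zero_right h, eval_hatPoly_neg_node] at hroot
  refine mul_ne_zero (div_ne_zero (mul_ne_zero p.coupling_ne_zero
    (Complex.ofReal_ne_zero.2 (p.ϱ_pos k).ne')) (p.add_ne_zero hw k))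
    (Finset.prod_ne_zero_iff.2 fun j hj => ?_) hroot
  rw [sub_eq_add_neg]
  exact ofReal_ne_neg_of_pos fun h => (mem_erase.1 hj).1 (p.ε_injective h).symm

lemma root_hatPoly_ne_node (p : Parameters lam N ε ϱ α) {w : ℂ}
    (hK : ∀ k, 𝒦 (ε k) w ≠ 0) {u : ℂ} (hu : u ∈ (𝒬 w).roots) (k : Fin d) :
    (ε k : ℂ) + -u ≠ 0 := by
  intro h
  have hroot : (𝒬 w).eval u = 0 := (mem_roots'.1 hu).2
  have hpos := p.add_ne_zero (p.ε_re_pos k)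
  rw [← sub_eq_add_neg, sub_eq_zero] at h
  rw [← h, eval_hatPoly lam N ϱ hpos] at hroot
  exact mul_ne_zero (Finset.prod_ne_zero_iff.2 fun j _ => hpos j) (hK k) hroot

lemma R_root_hatPoly (p : Parameters lam N ε ϱ α) {w : ℂ} (hw : 0 < w.re) {u : ℂ}
    (hu : u ∈ (𝒬 w).roots) : ℛ u = ℛ w := by
  have hroot : (𝒬 w).eval u = 0 := (mem_roots'.1 hu).2
  have hne := root_hatPoly_ne_neg_node p hw hu
  rw [eval_hatPoly lam N ϱ hne] at hroot
  rw [← sub_eq_zero, R_sub_R lam N ϱ hne (p.add_ne_zero hw),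
    (mul_eq_zero.1 hroot).resolve_left (Finset.prod_ne_zero_iff.2 fun k _ => hne k), mul_zero]

/-- For a preimage `u` of `R(w)`, the equation `R(w) - R(-u) = R(u) - R(-u)` expresses the value
at `-u` of the polynomial with roots `ŵ¹, …, ŵᵈ` through the zeros `αₖ` of `R(z) - R(-z)`. -/
lemma eval_hatPoly_neg_root (p : Parameters lam N ε ϱ α) {w : ℂ} (hw : 0 < w.re)
    (hK : ∀ k, 𝒦 (ε k) w ≠ 0) {u : ℂ} (hu : u ∈ (𝒬 w).roots) :
    (u + w) * ((𝒬 w).eval (-u) * ∏ k, (u + (ε k : ℂ)))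
      = 2 * (u + 0) * ∏ k, ((u + (α k : ℂ)) * (u + -(α k : ℂ)) * (-1)) := by
  have hne := root_hatPoly_ne_neg_node p hw hu
  have hne' := root_hatPoly_ne_node p hK hu
  have h1 : ∏ k, ((u + (α k : ℂ)) * (u + -(α k : ℂ)) * (-1))
      = (-1) ^ d * ∏ k, (u ^ 2 - (α k : ℂ) ^ 2) := by
    rw [Finset.prod_mul_distrib, Finset.prod_const, card_univ, Fintype.card_fin, mul_comm]
    congr 1
    exact Finset.prod_congr rfl fun k _ => by ring
  have h2 : ∏ k, (u ^ 2 - (ε k : ℂ) ^ 2) = (-1) ^ d *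
      ((∏ k, ((ε k : ℂ) + -u)) * ∏ k, (u + (ε k : ℂ))) := by
    rw [← Finset.prod_mul_distrib, Finset.prod_congr rfl fun k _ =>
      show u ^ 2 - (ε k : ℂ) ^ 2 = (-1) * (((ε k : ℂ) + -u) * (u + (ε k : ℂ))) by ring,
      Finset.prod_mul_distrib, Finset.prod_const, card_univ, Fintype.card_fin]
  have h3 := neg_one_pow_mul_self d
  have e1 := R_sub_R (ε := ε) lam N ϱ (p.add_ne_zero hw) hne'
  have e2 := R_sub_R (ε := ε) lam N ϱ hne hne'
  rw [R_root_hatPoly p hw hu, e1, dividedR_comm] at e2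
  rw [h1, ← prod_sq_sub_sq_mul_dividedR p hne hne', h2, eval_hatPoly lam N ϱ hne']
  linear_combination (∏ k, ((ε k : ℂ) + -u)) * (∏ k, (u + (ε k : ℂ))) * e2 -
    2 * u * (∏ k, ((ε k : ℂ) + -u)) * (∏ k, (u + (ε k : ℂ))) * 𝒦 u (-u) * h3

/-- The product of `eval_hatPoly_neg_root` over all preimages `u ≠ w` of `R(w)`. -/
lemma hatProd_self_mul (p : Parameters lam N ε ϱ α) {w : ℂ} (hw : 0 < w.re)
    (hK : ∀ k, 𝒦 (ε k) w ≠ 0) :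
    (𝒬 w).eval (-w) * 𝒮 w w * ∏ k, (𝒬 w).eval (-(ε k : ℂ))
      = 2 ^ d * (𝒬 w).eval 0 * ∏ k, ((𝒬 w).eval (α k : ℂ) * (𝒬 w).eval (-(α k : ℂ))) := by
  have h := congrArg Multiset.prod (Multiset.map_congr (s := (𝒬 w).roots) rfl
    fun u hu => eval_hatPoly_neg_root p hw hK hu)
  simp only [Multiset.prod_map_mul, multiset_prod_map_finset_prod, prod_add_roots_hatPoly,
    Multiset.map_const', Multiset.prod_replicate, card_roots_hatPoly, neg_neg, neg_zero] at h
  have h3 := neg_one_pow_mul_self d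
  have h4 : ∀ k, (-1) ^ d * (𝒬 w).eval (-(α k : ℂ)) * ((-1) ^ d * (𝒬 w).eval (α k : ℂ)) *
        (-1) ^ d
      = (-1) ^ d * ((𝒬 w).eval (α k : ℂ) * (𝒬 w).eval (-(α k : ℂ))) := fun k => by
    linear_combination (-1) ^ d * (𝒬 w).eval (α k : ℂ) * (𝒬 w).eval (-(α k : ℂ)) * h3
  have h5 : (∏ _k : Fin d, (-1 : ℂ) ^ d) ≠ 0 := by simp
  rw [Finset.prod_congr rfl fun k _ => h4 k, Finset.prod_mul_distrib, Finset.prod_mul_distrib] at h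
  have h6 : (-1 : ℂ) ^ d ≠ 0 := by simp
  refine mul_left_cancel₀ (mul_ne_zero h5 h6) ?_
  simp only [hatProd]
  linear_combination h

lemma eval_hatPoly_neg_self (p : Parameters lam N ε ϱ α) {w : ℂ} (hw : 0 < w.re)
    (hwε : ∀ k, (ε k : ℂ) + -w ≠ 0) :
    (𝒬 w).eval (-w) * ∏ k, ((ε k : ℂ) + w)
      = (∏ k, ((α k : ℂ) + -w)) * ∏ k, ((α k : ℂ) + w) := by
  have hsq : ∀ a : Fin d → ℝ, ∏ k, (w ^ 2 - (a k : ℂ) ^ 2)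
      = (-1) ^ d * ((∏ k, ((a k : ℂ) + -w)) * ∏ k, ((a k : ℂ) + w)) := fun a => by
    rw [← Finset.prod_mul_distrib, Finset.prod_congr rfl fun k _ =>
      show w ^ 2 - (a k : ℂ) ^ 2 = (-1) * (((a k : ℂ) + -w) * ((a k : ℂ) + w)) by ring,
      Finset.prod_mul_distrib, Finset.prod_const, card_univ, Fintype.card_fin]
  have h := prod_sq_sub_sq_mul_dividedR p (p.add_ne_zero hw) hwε
  rw [hsq, hsq] at h
  rw [eval_hatPoly lam N ϱ hwε, dividedR_comm]
  refine mul_left_cancel₀ (pow_ne_zero d (neg_ne_zero.2 one_ne_zero) : (-1 : ℂ) ^ d ≠ 0) ?_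
  linear_combination h

lemma prod_eval_hatPoly_neg_node (lam N : ℝ) (ϱ : Fin d → ℝ) {w : ℂ}
    (hw : ∀ k, (ε k : ℂ) + w ≠ 0) :
    (∏ k, (hatPoly lam N ε ϱ w).eval (-(ε k : ℂ))) * ∏ k, ((ε k : ℂ) + w)
      = ∏ k, ((lam / N : ℂ) * ϱ k * ∏ j ∈ univ.erase k, ((ε j : ℂ) - ε k)) := by
  rw [← Finset.prod_mul_distrib]
  refine Finset.prod_congr rfl fun k _ => ?_
  rw [eval_hatPoly_neg_node]
  field_simp [hw k]

/-- Since `R(αₖ) = R(-αₖ)`, the two values at `±αₖ` are proportional, with factor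
`(w - αₖ) / (w + αₖ)` up to the constant `∏ⱼ (εⱼ² - αₖ²)`. -/
lemma prod_eval_hatPoly_α (p : Parameters lam N ε ϱ α) {w : ℂ} (hw : 0 < w.re) :
    (∏ k, ((𝒬 w).eval (α k : ℂ) * (𝒬 w).eval (-(α k : ℂ)))) * ∏ k, ((α k : ℂ) + w)
      = (∏ k, ∏ j, ((ε j : ℂ) ^ 2 - (α k : ℂ) ^ 2)) * (∏ k, 𝒦 (α k) w) ^ 2 *
        ((-1) ^ d * ∏ k, ((α k : ℂ) + -w)) := by
  have hsign : ((-1 : ℂ) ^ d) = ∏ _k : Fin d, (-1 : ℂ) := by simp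
  rw [hsign, sq]
  simp only [← Finset.prod_mul_distrib]
  refine Finset.prod_congr rfl fun k _ => ?_
  have hp := p.add_ne_zero (p.α_re_pos k)
  have hm : ∀ j, (ε j : ℂ) + -(α k : ℂ) ≠ 0 := fun j => ofReal_ne_neg_of_pos (p.α_ne_ε k j)
  have e1 := R_sub_R (ε := ε) lam N ϱ hp (p.add_ne_zero hw)
  have e2 := R_sub_R (ε := ε) lam N ϱ hm (p.add_ne_zero hw)
  rw [← p.R_α k, e1] at e2
  have h : ∏ j, ((ε j : ℂ) ^ 2 - (α k : ℂ) ^ 2)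
      = (∏ j, ((ε j : ℂ) + α k)) * ∏ j, ((ε j : ℂ) + -(α k : ℂ)) := by
    rw [← Finset.prod_mul_distrib]
    exact Finset.prod_congr rfl fun j _ => by ring
  rw [eval_hatPoly lam N ϱ hp, eval_hatPoly lam N ϱ hm, h]
  linear_combination ((∏ j, ((ε j : ℂ) + α k)) * (∏ j, ((ε j : ℂ) + -(α k : ℂ))) *
    𝒦 (α k) w) * e2

lemma prod_prod_sq_sub_sq (p : Parameters lam N ε ϱ α) :
    ∏ k, ∏ j, ((ε j : ℂ) ^ 2 - (α k : ℂ) ^ 2)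
      = (∏ _k : Fin d, (-1) ^ d) *
        (∏ k, ((lam / N : ℂ) * ϱ k * ∏ j ∈ univ.erase k, ((ε j : ℂ) - ε k))) *
        ∏ k, ∏ j ∈ univ.erase k, ((ε k : ℂ) + ε j) := by
  rw [Finset.prod_comm]
  simp only [← Finset.prod_mul_distrib]
  refine Finset.prod_congr rfl fun k _ => ?_
  rw [← eval_oddPoly_eq_prod p, eval_oddPoly_node, Finset.prod_congr rfl fun j _ =>
    show (ε k : ℂ) ^ 2 - (ε j : ℂ) ^ 2 = (-1) * (((ε j : ℂ) - ε k) * ((ε k : ℂ) + ε j)) by ring,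
    Finset.prod_mul_distrib, Finset.prod_mul_distrib, Finset.prod_const]
  have h : ((-1 : ℂ) ^ d) = (-1) * (-1) ^ #(univ.erase k) := by
    rw [← pow_succ', card_erase_add_one (mem_univ k), card_univ, Fintype.card_fin]
  rw [h]
  ring

lemma prod_prod_add (ε : Fin d → ℝ) : ∏ k, ∏ l, ((ε k : ℂ) + (ε l : ℂ))
    = 2 ^ d * (∏ k, (ε k : ℂ)) * ∏ k, ∏ j ∈ univ.erase k, ((ε k : ℂ) + ε j) := by
  have h : (2 : ℂ) ^ d = ∏ _k : Fin d, 2 := by simp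
  rw [h]
  simp only [← Finset.prod_mul_distrib]
  refine Finset.prod_congr rfl fun k _ => ?_
  rw [← Finset.mul_prod_erase univ _ (mem_univ k)]
  ring

/-- The product `∏_{k,l} (-ŵᵏ - ŵˡ)` in closed form. After cancellation of `∏ₖ (αₖ - w)` only the
squares of `𝒦(αₖ, w) / (αₖ + w)` remain, and the constants combine to `∏_{k,l} (εₖ + εₗ)`. -/
lemma hatProd_self_of_ne (p : Parameters lam N ε ϱ α) {w : ℂ} (hw : 0 < w.re)
    (hK : ∀ k, 𝒦 (ε k) w ≠ 0) (hwε : ∀ k, (ε k : ℂ) + -w ≠ 0)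
    (hwα : ∀ k, (α k : ℂ) + -w ≠ 0) :
    𝒮 w w * (∏ k, ((α k : ℂ) + w)) ^ 2
      = (∏ k, ∏ l, ((ε k : ℂ) + (ε l : ℂ))) * 𝒦 0 w *
        ((∏ k, ((ε k : ℂ) + w)) * ∏ k, 𝒦 (α k) w) ^ 2 := by
  have h := hatProd_self_mul p hw hK
  have h1 := eval_hatPoly_neg_self p hw hwε
  have h2 := prod_eval_hatPoly_neg_node lam N ϱ (p.add_ne_zero hw)
  have h3 := eval_hatPoly (ε := ε) lam N ϱ (x := 0)
    (fun k => by simpa using (p.ε_pos k).ne') w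
  have h4 := prod_eval_hatPoly_α p hw
  have h5 := prod_prod_sq_sub_sq p
  have h6 := prod_prod_add ε
  have hA : ∏ k, ((α k : ℂ) + -w) ≠ 0 := Finset.prod_ne_zero_iff.2 fun k _ => hwα k
  have hP : ∏ k, ((lam / N : ℂ) * ϱ k * ∏ j ∈ univ.erase k, ((ε j : ℂ) - ε k)) ≠ 0 :=
    Finset.prod_ne_zero_iff.2 fun k _ => mul_ne_zero (mul_ne_zero p.coupling_ne_zero
      (Complex.ofReal_ne_zero.2 (p.ϱ_pos k).ne')) (Finset.prod_ne_zero_iff.2 fun j hj => by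
        rw [sub_eq_add_neg]
        exact ofReal_ne_neg_of_pos fun h => (mem_erase.1 hj).1 (p.ε_injective h).symm)
  have hs : (∏ _k : Fin d, (-1 : ℂ) ^ d) * (-1) ^ d = 1 := by
    rw [Finset.prod_const, card_univ, Fintype.card_fin, ← pow_mul, ← pow_add, ← Nat.mul_succ]
    exact (Nat.even_mul_succ_self d).neg_one_pow
  simp only [add_zero] at h3
  rw [h3] at h
  rw [h6]
  rw [h5] at h4
  set P := ∏ k, ((lam / N : ℂ) * ϱ k * ∏ j ∈ univ.erase k, ((ε j : ℂ) - ε k))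
  set A := ∏ k, ((α k : ℂ) + -w)
  set B := ∏ k, ((α k : ℂ) + w)
  set D := ∏ k, ((ε k : ℂ) + w)
  set F := ∏ k, ∏ j ∈ univ.erase k, ((ε k : ℂ) + ε j)
  set s := ∏ _k : Fin d, (-1 : ℂ) ^ d
  set s' := (-1 : ℂ) ^ d
  set q := (𝒬 w).eval (-w)
  set q' := ∏ k, (𝒬 w).eval (-(ε k : ℂ))
  set Y := ∏ k, ((𝒬 w).eval (α k : ℂ) * (𝒬 w).eval (-(α k : ℂ)))
  set Z := ∏ k, 𝒦 (α k) w
  set e := ∏ k, (ε k : ℂ)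
  refine mul_left_cancel₀ (mul_ne_zero hA hP) ?_
  linear_combination D ^ 2 * B * h - 𝒮 w w * B * q' * D * h1 - 𝒮 w w * B * A * B * h2 +
    2 ^ d * e * 𝒦 0 w * D ^ 2 * h4 + 2 ^ d * e * 𝒦 0 w * D ^ 2 * P * F * Z ^ 2 * A * hs

lemma prod_prod_add_ne_zero (p : Parameters lam N ε ϱ α) :
    ∏ k, ∏ l, ((ε k : ℂ) + (ε l : ℂ)) ≠ 0 :=
  Finset.prod_ne_zero_iff.2 fun k _ => Finset.prod_ne_zero_iff.2 fun l _ =>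
    p.add_ne_zero (p.ε_re_pos l) k

lemma prod_eval_hatPoly_node (p : Parameters lam N ε ϱ α) (z : ℂ) :
    ∏ k, (𝒬 z).eval (ε k : ℂ)
      = (∏ k, ∏ l, ((ε k : ℂ) + (ε l : ℂ))) * ∏ k, 𝒦 (ε k) z := by
  rw [← Finset.prod_mul_distrib]
  refine Finset.prod_congr rfl fun k _ => ?_
  rw [eval_hatPoly lam N ϱ (p.add_ne_zero (p.ε_re_pos k))]
  simp only [add_comm]

lemma twoPoint_eq_hatProd_div (p : Parameters lam N ε ϱ α) {z w : ℂ} (hz : 0 < z.re)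
    (hw : 0 < w.re) :
    twoPoint lam N ε ϱ z w = 𝒮 z w / ((z + w) * (∏ k, ∏ l, ((ε k : ℂ) + (ε l : ℂ))) *
      ((∏ k, 𝒦 (ε k) z) * ∏ k, 𝒦 (ε k) w)) := by
  have hC := prod_prod_add_ne_zero p
  rw [twoPoint_eq lam N ϱ (p.add_ne_zero hz) (p.add_ne_zero hw), prod_eval_hatPoly_node p,
    prod_eval_hatPoly_node p, one_div_mul_eq_div, div_div,
    ← mul_div_mul_left (𝒮 z w) _ hC]
  congr 1
  ring

lemma twoPoint_comm (p : Parameters lam N ε ϱ α) {z w : ℂ} (hz : 0 < z.re) (hw : 0 < w.re) :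
    twoPoint lam N ε ϱ z w = twoPoint lam N ε ϱ w z := by
  rw [twoPoint_eq_hatProd_div p hz hw, twoPoint_eq_hatProd_div p hw hz, hatProd_comm, add_comm z,
    mul_comm (∏ k, 𝒦 (ε k) z)]

/-- The function `1 / (R(z) - R(-z)) ∏ₖ (R(z) - R(αₖ)) / (R(z) - R(εₖ))` in a form without
removable singularities in the right half plane. -/
noncomputable def diagFactor (lam N : ℝ) (ε ϱ α : Fin d → ℝ) (z : ℂ) : ℂ :=
  (∏ k, ((ε k : ℂ) + z)) * (∏ k, dividedR lam N ε ϱ (α k) z) /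
    (2 * z * (∏ k, ((α k : ℂ) + z)) * ∏ k, dividedR lam N ε ϱ (ε k) z)

local notation "𝒯" => diagFactor lam N ε ϱ α

lemma differentiableAt_dividedR_right (p : Parameters lam N ε ϱ α) {a z : ℂ} (ha : 0 < a.re)
    (hz : 0 < z.re) : DifferentiableAt ℂ (fun z => 𝒦 a z) z :=
  DifferentiableAt.fun_comp' (f := fun z => (a, z)) z
    (differentiableAt_dividedR (p.add_ne_zero ha) (p.add_ne_zero hz))
    ((differentiableAt_const a).prodMk differentiableAt_id)

lemma ne_zero_of_re_pos {z : ℂ} (hz : 0 < z.re) : z ≠ 0 := fun h => by simp [h] at hz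

lemma eventually_punctured_ne (a w : ℂ) : ∀ᶠ z in nhdsWithin w {w}ᶜ, z ≠ a := by
  rcases eq_or_ne w a with rfl | h
  · exact self_mem_nhdsWithin
  · exact nhdsWithin_le_nhds (isOpen_ne.mem_nhds h)

lemma eq_of_eventuallyEq_punctured {f g : ℂ → ℂ} {w : ℂ} (hf : ContinuousAt f w)
    (hg : ContinuousAt g w) (h : f =ᶠ[nhdsWithin w {w}ᶜ] g) : f w = g w :=
  tendsto_nhds_unique ((hf.tendsto.mono_left nhdsWithin_le_nhds).congr' h)
    (hg.tendsto.mono_left nhdsWithin_le_nhds)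

namespace Region

variable (hV : Region lam N ε ϱ V) (p : Parameters lam N ε ϱ α)
include hV

lemma ε_mem (p : Parameters lam N ε ϱ α) (k : Fin d) : (ε k : ℂ) ∈ V :=
  hV.ofReal_mem _ (p.ε_pos k)

lemma α_mem (p : Parameters lam N ε ϱ α) (k : Fin d) : (α k : ℂ) ∈ V :=
  hV.ofReal_mem _ (p.α_pos k)

include p

lemma prod_dividedR_node_ne_zero {z : ℂ} (hz : z ∈ V) : ∏ k, 𝒦 (ε k) z ≠ 0 :=
  Finset.prod_ne_zero_iff.2 fun k _ => dividedR_ne_zero p hV (hV.ε_mem p k) hz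

lemma differentiableAt_diagFactor {z : ℂ} (hz : z ∈ V) : DifferentiableAt ℂ 𝒯 z := by
  have hz' := hV.re_pos z hz
  have h1 : ∀ a : Fin d → ℝ, DifferentiableAt ℂ (fun z => ∏ k, ((a k : ℂ) + z)) z := fun a =>
    differentiableAt_finset_prod fun k _ => by fun_prop
  have h2 : ∀ a : Fin d → ℝ, (∀ k, 0 < a k) →
      DifferentiableAt ℂ (fun z => ∏ k, 𝒦 (a k) z) z := fun a ha =>
    differentiableAt_finset_prod fun k _ =>
      differentiableAt_dividedR_right p (by simpa using ha k) hz'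
  refine ((h1 ε).mul (h2 α p.α_pos)).div
    (((differentiableAt_id.const_mul 2).mul (h1 α)).mul (h2 ε p.ε_pos)) ?_
  exact mul_ne_zero (mul_ne_zero (mul_ne_zero two_ne_zero (ne_zero_of_re_pos hz'))
    (Finset.prod_ne_zero_iff.2 fun k _ => p.α_add_ne_zero hz' k))
    (hV.prod_dividedR_node_ne_zero p hz)

lemma differentiableAt_twoPoint {z w : ℂ} (hz : z ∈ V) (hw : w ∈ V) :
    DifferentiableAt ℂ (fun q : ℂ × ℂ => twoPoint lam N ε ϱ q.1 q.2) (z, w) := by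
  have hz' := hV.re_pos z hz
  have hw' := hV.re_pos w hw
  have hev : (fun q : ℂ × ℂ => twoPoint lam N ε ϱ q.1 q.2) =ᶠ[nhds (z, w)]
      fun q => 𝒮 q.1 q.2 * ((q.1 + q.2) * (∏ k, ∏ l, ((ε k : ℂ) + (ε l : ℂ))) *
        ((∏ k, 𝒦 (ε k) q.1) * ∏ k, 𝒦 (ε k) q.2))⁻¹ := by
    filter_upwards [(hV.isOpen.prod hV.isOpen).mem_nhds (Set.mk_mem_prod hz hw)] with q hq
    rw [twoPoint_eq_hatProd_div p (hV.re_pos _ hq.1) (hV.re_pos _ hq.2), div_eq_mul_inv]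
  refine DifferentiableAt.congr_of_eventuallyEq ?_ hev
  have h2 : ∀ {x : ℂ}, x ∈ V → DifferentiableAt ℂ (fun z => ∏ k, 𝒦 (ε k) z) x := fun hx =>
    differentiableAt_finset_prod fun k _ =>
      differentiableAt_dividedR_right p (p.ε_re_pos k) (hV.re_pos _ hx)
  have h3 := DifferentiableAt.fun_comp' (f := Prod.fst) (z, w) (h2 hz) differentiableAt_fst
  have h4 := DifferentiableAt.fun_comp' (f := Prod.snd) (z, w) (h2 hw) differentiableAt_snd
  have h5 : DifferentiableAt ℂ (fun q : ℂ × ℂ =>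
      (q.1 + q.2) * (∏ k, ∏ l, ((ε k : ℂ) + (ε l : ℂ)))) (z, w) := by fun_prop
  refine (differentiableAt_hatProd (p.add_ne_zero hz') (p.add_ne_zero hw')).mul
    ((h5.mul (h3.mul h4)).inv ?_)
  exact mul_ne_zero (mul_ne_zero (ne_zero_of_re_pos (by simpa using add_pos hz' hw'))
    (prod_prod_add_ne_zero p))
    (mul_ne_zero (hV.prod_dividedR_node_ne_zero p hz) (hV.prod_dividedR_node_ne_zero p hw))

lemma continuousAt_twoPoint_self {w : ℂ} (hw : w ∈ V) :
    ContinuousAt (fun z => twoPoint lam N ε ϱ z z) w :=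
  ContinuousAt.comp (f := fun z => (z, z)) (hV.differentiableAt_twoPoint p hw hw).continuousAt
    (continuousAt_id.prodMk continuousAt_id)

/-- The two-point function on the diagonal: `𝒢(w,w) = 2 (R(w) - R(0)) T(w)²`. -/
lemma twoPoint_self {w : ℂ} (hw : w ∈ V) :
    twoPoint lam N ε ϱ w w = 2 * (ℛ w - ℛ 0) * 𝒯 w ^ 2 := by
  have hR := (differentiableAt_R (lam := lam) (N := N) (ϱ := ϱ)
    (p.add_ne_zero (hV.re_pos w hw))).continuousAt
  have hT := (hV.differentiableAt_diagFactor p hw).continuousAt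
  refine eq_of_eventuallyEq_punctured (f := fun w => twoPoint lam N ε ϱ w w)
    (g := fun w => 2 * (ℛ w - ℛ 0) * 𝒯 w ^ 2) (hV.continuousAt_twoPoint_self p hw)
    ((continuousAt_const.mul (hR.sub continuousAt_const)).mul (hT.pow 2)) ?_
  -- away from the points `εₖ` and `αₖ` the denominators of `hatProd_self_of_ne` do not vanish
  filter_upwards [nhdsWithin_le_nhds (hV.isOpen.mem_nhds hw),
    Filter.eventually_all.2 fun k => eventually_punctured_ne (ε k : ℂ) w,
    Filter.eventually_all.2 fun k => eventually_punctured_ne (α k : ℂ) w] with z hz hzε hzα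
  have hz' := hV.re_pos z hz
  have hS := hatProd_self_of_ne p hz' (fun k => dividedR_ne_zero p hV (hV.ε_mem p k) hz)
    (fun k h => hzε k (by linear_combination -h)) (fun k h => hzα k (by linear_combination -h))
  have hR0 := R_sub_R (ε := ε) lam N ϱ (p.add_ne_zero hz') (w := 0)
    (fun k => by simpa using (p.ε_pos k).ne')
  rw [twoPoint_eq_hatProd_div p hz' hz', hR0, dividedR_comm lam N ε ϱ z 0, diagFactor]
  have hC := prod_prod_add_ne_zero p
  have hz0 := ne_zero_of_re_pos hz'
  have hB : ∏ k, ((α k : ℂ) + z) ≠ 0 :=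
    Finset.prod_ne_zero_iff.2 fun k _ => p.α_add_ne_zero hz' k
  have hP := hV.prod_dividedR_node_ne_zero p hz
  rw [← two_mul]
  field_simp
  linear_combination z * hS

end Region

/-! ### The candidate for the planar `1+1`-point function -/

/-- A differentiable symmetric function of two variables that vanishes on the diagonal vanishes
there to second order. -/
lemma deriv_eq_zero_of_symmetric {F : ℂ → ℂ → ℂ} {w : ℂ}
    (hF : DifferentiableAt ℂ (fun q : ℂ × ℂ => F q.1 q.2) (w, w))
    (hs : ∀ᶠ z in nhds w, F z w = F w z) (h0 : ∀ᶠ z in nhds w, F z z = 0) :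
    deriv (fun z => F z w) w = 0 := by
  obtain ⟨L, hL⟩ := hF
  have h1 : HasDerivAt (fun z => F z w) (L (1, 0)) w :=
    HasFDerivAt.comp_hasDerivAt (f := fun z => (z, w)) w hL
      ((hasDerivAt_id w).prodMk (hasDerivAt_const w w))
  have h2 : HasDerivAt (fun z => F w z) (L (0, 1)) w :=
    HasFDerivAt.comp_hasDerivAt (f := fun z => (w, z)) w hL
      ((hasDerivAt_const w w).prodMk (hasDerivAt_id w))
  have h3 : HasDerivAt (fun z => F z z) (L (1, 1)) w :=
    HasFDerivAt.comp_hasDerivAt (f := fun z => (z, z)) w hL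
      ((hasDerivAt_id w).prodMk (hasDerivAt_id w))
  have e1 : L (1, 0) = L (0, 1) := h1.unique (h2.congr_of_eventuallyEq hs)
  have e2 : L (1, 1) = 0 := h3.unique ((hasDerivAt_const w (0 : ℂ)).congr_of_eventuallyEq h0)
  have e3 : L (1, 1) = L (1, 0) + L (0, 1) := by rw [← map_add]; simp
  rw [h1.deriv]
  linear_combination (1 / 2 : ℂ) * (e2 - e3 + e1)

/-- The numerator `𝒢(z,w) - (R(z) + R(w) - 2R(0)) T(z) T(w)` of the planar `1+1`-point
function, where `T` is `diagFactor`. -/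
noncomputable def defect (lam N : ℝ) (ε ϱ α : Fin d → ℝ) (z w : ℂ) : ℂ :=
  twoPoint lam N ε ϱ z w - (R lam N ε ϱ z + R lam N ε ϱ w - 2 * R lam N ε ϱ 0) *
    (diagFactor lam N ε ϱ α z * diagFactor lam N ε ϱ α w)

/-- The planar `1+1`-point function `λ (R(z) - R(w))⁻² defect(z,w)`. The double zero
of the numerator on the diagonal is divided out by two divided differences. -/
noncomputable def onePlusOne (lam N : ℝ) (ε ϱ α : Fin d → ℝ) (z w : ℂ) : ℂ :=
  lam * dslope (dslope (fun z => defect lam N ε ϱ α z w) w) w z / dividedR lam N ε ϱ z w ^ 2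

namespace Region

variable (hV : Region lam N ε ϱ V) (p : Parameters lam N ε ϱ α)
include hV p

lemma differentiableAt_defect {z w : ℂ} (hz : z ∈ V) (hw : w ∈ V) :
    DifferentiableAt ℂ (fun q : ℂ × ℂ => defect lam N ε ϱ α q.1 q.2) (z, w) := by
  have hR : ∀ {x : ℂ}, x ∈ V → DifferentiableAt ℂ ℛ x := fun hx =>
    differentiableAt_R (p.add_ne_zero (hV.re_pos _ hx))
  have h1 := DifferentiableAt.fun_comp' (f := Prod.fst) (z, w) (hR hz) differentiableAt_fst
  have h2 := DifferentiableAt.fun_comp' (f := Prod.snd) (z, w) (hR hw) differentiableAt_snd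
  have h3 := DifferentiableAt.fun_comp' (f := Prod.fst) (z, w)
    (hV.differentiableAt_diagFactor p hz) differentiableAt_fst
  have h4 := DifferentiableAt.fun_comp' (f := Prod.snd) (z, w)
    (hV.differentiableAt_diagFactor p hw) differentiableAt_snd
  exact (hV.differentiableAt_twoPoint p hz hw).sub
    (((h1.add h2).sub (differentiableAt_const _)).mul (h3.mul h4))

lemma defect_comm {z w : ℂ} (hz : z ∈ V) (hw : w ∈ V) :
    defect lam N ε ϱ α z w = defect lam N ε ϱ α w z := by
  rw [defect, defect, twoPoint_comm p (hV.re_pos z hz) (hV.re_pos w hw)]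
  ring

lemma defect_self {w : ℂ} (hw : w ∈ V) : defect lam N ε ϱ α w w = 0 := by
  rw [defect, hV.twoPoint_self p hw]
  ring

lemma deriv_defect {w : ℂ} (hw : w ∈ V) : deriv (fun z => defect lam N ε ϱ α z w) w = 0 :=
  deriv_eq_zero_of_symmetric (hV.differentiableAt_defect p hw hw)
    (Filter.eventually_of_mem (hV.isOpen.mem_nhds hw) fun _ hz => hV.defect_comm p hz hw)
    (Filter.eventually_of_mem (hV.isOpen.mem_nhds hw) fun _ hz => hV.defect_self p hz)

lemma sq_mul_onePlusOne {z w : ℂ} (hz : z ∈ V) (hw : w ∈ V) :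
    (ℛ z - ℛ w) ^ 2 * onePlusOne lam N ε ϱ α z w = lam * defect lam N ε ϱ α z w := by
  have h1 := sub_smul_dslope_of_zero (f := fun z => defect lam N ε ϱ α z w) (a := w)
    (hV.defect_self p hw) z
  have h2 := sub_smul_dslope_of_zero (f := dslope (fun z => defect lam N ε ϱ α z w) w) (a := w)
    (by rw [dslope_same, hV.deriv_defect p hw]) z
  rw [smul_eq_mul] at h1 h2
  rw [R_sub_R lam N ϱ (p.add_ne_zero (hV.re_pos z hz)) (p.add_ne_zero (hV.re_pos w hw)),
    onePlusOne, ← h1, ← h2]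
  have := dividedR_ne_zero p hV hz hw
  field_simp

omit p in
lemma R_sub_R_ne_zero {z w : ℂ} (hz : z ∈ V) (hw : w ∈ V) (h : z ≠ w) : ℛ z - ℛ w ≠ 0 :=
  sub_ne_zero.2 fun h' => h (hV.injOn hz hw h')

lemma onePlusOne_comm {z w : ℂ} (hz : z ∈ V) (hw : w ∈ V) :
    onePlusOne lam N ε ϱ α z w = onePlusOne lam N ε ϱ α w z := by
  rcases eq_or_ne z w with rfl | h
  · rfl
  · refine mul_left_cancel₀ (pow_ne_zero 2 (hV.R_sub_R_ne_zero hz hw h)) ?_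
    rw [hV.sq_mul_onePlusOne p hz hw, hV.defect_comm p hz hw, ← hV.sq_mul_onePlusOne p hw hz]
    ring

lemma differentiableOn_onePlusOne {w : ℂ} (hw : w ∈ V) :
    DifferentiableOn ℂ (fun z => onePlusOne lam N ε ϱ α z w) V := by
  have hn := hV.isOpen.mem_nhds hw
  have h1 : DifferentiableOn ℂ (fun z => defect lam N ε ϱ α z w) V := fun z hz =>
    (DifferentiableAt.fun_comp' (f := fun z => (z, w)) z (hV.differentiableAt_defect p hz hw)
      (differentiableAt_id.prodMk (differentiableAt_const w))).differentiableWithinAt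
  have h2 : DifferentiableOn ℂ (fun z => 𝒦 z w) V := fun z hz => by
    simp only [fun z => dividedR_comm lam N ε ϱ z w]
    exact (differentiableAt_dividedR_right p (hV.re_pos w hw)
      (hV.re_pos z hz)).differentiableWithinAt
  have h3 := (Complex.differentiableOn_dslope hn).2 ((Complex.differentiableOn_dslope hn).2 h1)
  exact (h3.const_mul _).div (h2.pow 2) fun z hz => pow_ne_zero 2 (dividedR_ne_zero p hV hz hw)

lemma continuousAt_onePlusOne_left {z w : ℂ} (hz : z ∈ V) (hw : w ∈ V) :
    ContinuousAt (fun z => onePlusOne lam N ε ϱ α z w) z :=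
  ((hV.differentiableOn_onePlusOne p hw).differentiableAt (hV.isOpen.mem_nhds hz)).continuousAt

lemma continuousAt_onePlusOne_right {z w : ℂ} (hz : z ∈ V) (hw : w ∈ V) :
    ContinuousAt (fun w => onePlusOne lam N ε ϱ α z w) w :=
  (hV.continuousAt_onePlusOne_left p hw hz).congr (Filter.eventually_of_mem
    (hV.isOpen.mem_nhds hw) fun _ hx => hV.onePlusOne_comm p hx hz)

/-! ### The factors as rational functions of `R(z)` -/

omit hV in
lemma R_sub_R_neg {z : ℂ} (hz : 0 < z.re) (hzε : ∀ k, z ≠ (ε k : ℂ)) :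
    ℛ z - ℛ (-z) = 2 * z * 𝒦 z (-z) := by
  rw [R_sub_R lam N ϱ (p.add_ne_zero hz)
    (fun k h => hzε k (by linear_combination -h))]
  ring

lemma prod_R_sub_R (a : Fin d → ℝ) (ha : ∀ k, 0 < a k) {z : ℂ} (hz : z ∈ V) :
    ∏ k, (ℛ z - ℛ (a k : ℂ)) = (∏ k, (z - (a k : ℂ))) * ∏ k, 𝒦 (a k) z := by
  rw [← Finset.prod_mul_distrib]
  refine Finset.prod_congr rfl fun k _ => ?_
  rw [R_sub_R lam N ϱ (p.add_ne_zero (hV.re_pos z hz)) (p.add_ne_zero (by simpa using ha k)),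
    dividedR_comm]

lemma diagFactor_mul {z : ℂ} (hz : z ∈ V) (hzε : ∀ k, z ≠ (ε k : ℂ)) :
    (ℛ z - ℛ (-z)) * 𝒯 z * ∏ k, (ℛ z - ℛ (ε k : ℂ)) = ∏ k, (ℛ z - ℛ (α k : ℂ)) := by
  have hz' := hV.re_pos z hz
  have h := prod_sq_sub_sq_mul_dividedR p (p.add_ne_zero hz')
    (fun k h => hzε k (by linear_combination -h))
  have hsq : ∀ a : Fin d → ℝ, ∏ k, (z ^ 2 - (a k : ℂ) ^ 2)
      = (∏ k, (z - (a k : ℂ))) * ∏ k, ((a k : ℂ) + z) := fun a => by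
    rw [← Finset.prod_mul_distrib]
    exact Finset.prod_congr rfl fun k _ => by ring
  rw [hsq, hsq] at h
  rw [hV.prod_R_sub_R p ε p.ε_pos hz, hV.prod_R_sub_R p α p.α_pos hz, R_sub_R_neg p hz' hzε,
    diagFactor]
  have hz0 := ne_zero_of_re_pos hz'
  have hB : ∏ k, ((α k : ℂ) + z) ≠ 0 :=
    Finset.prod_ne_zero_iff.2 fun k _ => p.α_add_ne_zero hz' k
  have hP := hV.prod_dividedR_node_ne_zero p hz
  field_simp
  linear_combination (∏ k, 𝒦 (α k) z) * h

lemma R_sub_R_neg_ne_zero {z : ℂ} (hz : z ∈ V) (hzε : ∀ k, z ≠ (ε k : ℂ))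
    (hzα : ∀ k, z ≠ (α k : ℂ)) : ℛ z - ℛ (-z) ≠ 0 := by
  intro h
  have h1 := hV.diagFactor_mul p hz hzε
  rw [h, zero_mul, zero_mul] at h1
  exact Finset.prod_ne_zero_iff.2 (fun k _ => hV.R_sub_R_ne_zero hz (hV.α_mem p k) (hzα k))
    h1.symm

/-- For fixed `w` the function `(R(w) - R(-z)) 𝒢(z,w)` is a rational function of `R(z)`. -/
lemma twoPoint_mul {z w : ℂ} (hz : z ∈ V) (hw : w ∈ V) (hzε : ∀ k, z ≠ (ε k : ℂ)) :
    (ℛ w - ℛ (-z)) * twoPoint lam N ε ϱ z w * ∏ k, (ℛ z - ℛ (ε k : ℂ))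
      = ((𝒬 w).roots.map fun u => ℛ z - ℛ (-u)).prod := by
  have hz' := hV.re_pos z hz
  have hw' := hV.re_pos w hw
  have hzm : ∀ k, (ε k : ℂ) + -z ≠ 0 := fun k h => hzε k (by linear_combination -h)
  have hroot : ∀ u ∈ (𝒬 w).roots, (ℛ z - ℛ (-u)) * ∏ k, ((ε k : ℂ) - u)
      = (u + z) * (𝒬 z).eval (-u) := fun u hu => by
    have hne := root_hatPoly_ne_node p (fun k => dividedR_ne_zero p hV (hV.ε_mem p k) hw) hu
    rw [R_sub_R lam N ϱ (p.add_ne_zero hz') hne, eval_hatPoly lam N ϱ hne, dividedR_comm]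
    simp only [← sub_eq_add_neg]
    ring
  have h := congrArg Multiset.prod (Multiset.map_congr (s := (𝒬 w).roots) rfl hroot)
  simp only [Multiset.prod_map_mul, multiset_prod_map_finset_prod, prod_add_roots_hatPoly,
    prod_sub_roots_hatPoly] at h
  rw [prod_eval_hatPoly_node p, eval_hatPoly lam N ϱ hzm, ← hatProd] at h
  have hC := prod_prod_add_ne_zero p
  have hP := hV.prod_dividedR_node_ne_zero p hw
  have hP' := hV.prod_dividedR_node_ne_zero p hz
  have hzw : z + w ≠ 0 := ne_zero_of_re_pos (by simpa using add_pos hz' hw')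
  have hs : ∏ k, (z - (ε k : ℂ)) = (-1) ^ d * ∏ k, ((ε k : ℂ) + -z) := by
    rw [Finset.prod_congr rfl fun k _ =>
      show z - (ε k : ℂ) = (-1) * ((ε k : ℂ) + -z) by ring, Finset.prod_mul_distrib,
      Finset.prod_const, card_univ, Fintype.card_fin]
  refine mul_left_cancel₀ (mul_ne_zero hC hP) ?_
  rw [mul_comm (_ * _) (Multiset.prod _), h, hV.prod_R_sub_R p ε p.ε_pos hz, hs,
    R_sub_R lam N ϱ (p.add_ne_zero hw') hzm, dividedR_comm, twoPoint_eq_hatProd_div p hz' hw']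
  field_simp
  ring

end Region

/-! ### The affine equation -/

/-- For fixed `w` the polynomial in `t = R(z)` that is the numerator of
`(R(z) - R(-z)) defect(z,w) - (R(z) - R(w)) (𝒢(z,w) - 𝒢(w,w))` over the common denominator
`∏ₖ (t - R(εₖ))`. -/
noncomputable def equationNum (lam N : ℝ) (ε ϱ α : Fin d → ℝ) (w : ℂ) : ℂ[X] :=
  ((hatPoly lam N ε ϱ w).roots.map fun u => X - C (R lam N ε ϱ (-u))).prod
    - C (diagFactor lam N ε ϱ α w) * (X + C (R lam N ε ϱ w - 2 * R lam N ε ϱ 0)) *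
      ∏ k, (X - C (R lam N ε ϱ (α k)))
    + C (twoPoint lam N ε ϱ w w) * (X - C (R lam N ε ϱ w)) * ∏ k, (X - C (R lam N ε ϱ (ε k)))

lemma natDegree_equationNum_le (w : ℂ) : (equationNum lam N ε ϱ α w).natDegree ≤ d + 1 := by
  have hprod : ∀ a : Fin d → ℂ, (∏ k, (X - C (a k))).natDegree ≤ d := fun a => by
    rw [natDegree_prod_of_monic _ _ fun k _ => monic_X_sub_C _]
    simp
  have hmul : ∀ (b c : ℂ) (a : Fin d → ℂ),
      (C b * (X + C c) * ∏ k, (X - C (a k))).natDegree ≤ d + 1 := fun b c a => by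
    refine natDegree_mul_le.trans ?_
    have h1 := (natDegree_C_mul_le b (X + C c)).trans_eq (natDegree_X_add_C c)
    have h2 := hprod a
    omega
  refine natDegree_add_le_of_degree_le
    ((natDegree_sub_le_of_le (m := d + 1) ?_ (hmul _ _ _)).trans_eq (max_self _)) ?_
  · have h := natDegree_multiset_prod_X_sub_C_eq_card ((𝒬 w).roots.map fun u => ℛ (-u))
    rw [Multiset.map_map, Multiset.card_map, card_roots_hatPoly] at h
    exact h.le.trans d.le_succ
  · rw [sub_eq_add_neg X, ← C_neg]
    exact hmul _ _ _

namespace Region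

variable (hV : Region lam N ε ϱ V) (p : Parameters lam N ε ϱ α)
include hV p

/-- The identity `R(w) - R(-z) = (R(z) - R(-z)) - (R(z) - R(w))` turns the numerators of the
two-point function and of `diagFactor` into this combination. -/
lemma eval_equationNum {z w : ℂ} (hz : z ∈ V) (hw : w ∈ V) (hzε : ∀ k, z ≠ (ε k : ℂ)) :
    (equationNum lam N ε ϱ α w).eval (ℛ z) = (∏ k, (ℛ z - ℛ (ε k : ℂ))) *
      ((ℛ z - ℛ (-z)) * defect lam N ε ϱ α z w
        - (ℛ z - ℛ w) * (twoPoint lam N ε ϱ z w - twoPoint lam N ε ϱ w w)) := by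
  have h1 : (((𝒬 w).roots.map fun u => X - C (ℛ (-u))).prod).eval (ℛ z)
      = ((𝒬 w).roots.map fun u => ℛ z - ℛ (-u)).prod := by
    rw [eval_multiset_prod, Multiset.map_map]
    simp
  rw [equationNum, eval_add, eval_sub, h1, ← hV.twoPoint_mul p hz hw hzε]
  simp only [eval_mul, eval_C, eval_add, eval_sub, eval_X, eval_prod]
  rw [← hV.diagFactor_mul p hz hzε, defect]
  ring

omit hV in
lemma continuousAt_R {z : ℂ} (hz : 0 < z.re) : ContinuousAt ℛ z :=
  (differentiableAt_R (p.add_ne_zero hz)).continuousAt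

omit hV p in
lemma continuousAt_R_neg {z : ℂ} (hzε : ∀ k, z ≠ (ε k : ℂ)) :
    ContinuousAt (fun z => ℛ (-z)) z :=
  ContinuousAt.comp (f := fun z : ℂ => -z) (differentiableAt_R
    (fun k h => hzε k (by linear_combination -h))).continuousAt continuousAt_neg

lemma continuousAt_twoPoint_left {z w : ℂ} (hz : z ∈ V) (hw : w ∈ V) :
    ContinuousAt (fun z => twoPoint lam N ε ϱ z w) z :=
  ContinuousAt.comp (f := fun z => (z, w)) (hV.differentiableAt_twoPoint p hz hw).continuousAt
    (continuousAt_id.prodMk continuousAt_const)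

lemma continuousAt_twoPoint_right {z w : ℂ} (hz : z ∈ V) (hw : w ∈ V) :
    ContinuousAt (fun w => twoPoint lam N ε ϱ z w) w :=
  ContinuousAt.comp (f := fun w => (z, w)) (hV.differentiableAt_twoPoint p hz hw).continuousAt
    (continuousAt_const.prodMk continuousAt_id)

/-- The double zero of the defect on the diagonal makes `(t - R(w))²` divide the numerator. -/
lemma exists_equationNum_eq {w : ℂ} (hw : w ∈ V) (hwε : ∀ k, w ≠ (ε k : ℂ)) :
    ∃ L : ℂ[X], L.degree < d ∧
      equationNum lam N ε ϱ α w = (X - C (ℛ w)) * ((X - C (ℛ w)) * L) := by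
  have hw' := hV.re_pos w hw
  obtain ⟨M, hM⟩ : X - C (ℛ w) ∣ equationNum lam N ε ϱ α w := by
    rw [dvd_iff_isRoot, IsRoot, hV.eval_equationNum p hw hw hwε, hV.defect_self p hw]
    ring
  have hMz : M.eval (ℛ w) = (∏ k, (ℛ w - ℛ (ε k : ℂ))) *
      ((ℛ w - ℛ (-w)) * ((ℛ w - ℛ w) * onePlusOne lam N ε ϱ α w w / lam)
        - (twoPoint lam N ε ϱ w w - twoPoint lam N ε ϱ w w)) := by
    have hR := continuousAt_R p hw'
    refine eq_of_eventuallyEq_punctured (f := fun z => M.eval (ℛ z))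
      (g := fun z => (∏ k, (ℛ z - ℛ (ε k : ℂ))) *
        ((ℛ z - ℛ (-z)) * ((ℛ z - ℛ w) * onePlusOne lam N ε ϱ α z w / lam)
        - (twoPoint lam N ε ϱ z w - twoPoint lam N ε ϱ w w))) (M.continuous.continuousAt.comp hR)
      ?_ ?_
    · refine ContinuousAt.mul (tendsto_finsetProd _ fun k _ => hR.sub continuousAt_const) ?_
      exact ((hR.sub (continuousAt_R_neg hwε)).mul (((hR.sub continuousAt_const).mul
        (hV.continuousAt_onePlusOne_left p hw hw)).div_const _)).sub
        ((hV.continuousAt_twoPoint_left p hw hw).sub continuousAt_const)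
    · filter_upwards [nhdsWithin_le_nhds (hV.isOpen.mem_nhds hw), self_mem_nhdsWithin,
        Filter.eventually_all.2 fun k => eventually_punctured_ne (ε k : ℂ) w] with z hz hzw hzε
      have h1 := hV.eval_equationNum p hz hw hzε
      have h2 := hV.sq_mul_onePlusOne p hz hw
      have hlam : (lam : ℂ) ≠ 0 := Complex.ofReal_ne_zero.2 p.lam_pos.ne'
      have h3 : defect lam N ε ϱ α z w = (ℛ z - ℛ w) ^ 2 * onePlusOne lam N ε ϱ α z w / lam := by
        rw [h2, mul_div_cancel_left₀ _ hlam]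
      rw [hM, h3] at h1
      simp only [eval_mul, eval_sub, eval_X, eval_C] at h1
      refine mul_left_cancel₀ (hV.R_sub_R_ne_zero hz hw hzw) (h1.trans ?_)
      ring
  obtain ⟨L, rfl⟩ : X - C (ℛ w) ∣ M := by
    rw [dvd_iff_isRoot, IsRoot, hMz]
    ring
  refine ⟨L, ?_, hM⟩
  rcases eq_or_ne L 0 with rfl | hL
  · simp
  · have h1 := natDegree_equationNum_le (lam := lam) (N := N) (ε := ε) (ϱ := ϱ) (α := α) w
    have hX := X_sub_C_ne_zero (ℛ w)
    rw [hM, natDegree_mul hX (mul_ne_zero hX hL), natDegree_mul hX hL, natDegree_X_sub_C] at h1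
    rw [degree_eq_natDegree hL]
    exact_mod_cast (by omega : L.natDegree < d)

/-- The value of the quotient at the node `R(εₖ)` comes from the simple pole of `R(-z)` at
`z = εₖ`, which has residue `(λ/N) ϱₖ R'(εₖ)` in the variable `R(z)`. -/
lemma eval_residue {w : ℂ} (hw : w ∈ V) (hwε : ∀ k, w ≠ (ε k : ℂ)) {L : ℂ[X]}
    (hL : equationNum lam N ε ϱ α w = (X - C (ℛ w)) * ((X - C (ℛ w)) * L)) (k : Fin d) :
    lam * L.eval (ℛ (ε k : ℂ))
      = -((lam / N : ℂ) * (ϱ k * 𝒦 (ε k) (ε k)) * onePlusOne lam N ε ϱ α (ε k) w) *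
        ∏ j ∈ univ.erase k, (ℛ (ε k : ℂ) - ℛ (ε j : ℂ)) := by
  have hk := hV.ε_mem p k
  have hk' := p.ε_re_pos k
  have hR := continuousAt_R p hk'
  have hkw := hV.R_sub_R_ne_zero hk hw (hwε k).symm
  -- `z ↦ (z - εₖ) 𝒦(z, -z)` without its removable singularity at `εₖ`
  let ψ : ℂ → ℂ := fun z => (z - ε k) * (1 + (lam / N : ℂ) *
    ∑ j ∈ univ.erase k, (ϱ j : ℂ) / (((ε j : ℂ) + z) * ((ε j : ℂ) + -z)))
    - (lam / N : ℂ) * ((ϱ k : ℂ) / ((ε k : ℂ) + z))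
  have hψc : ContinuousAt ψ (ε k) := by
    refine ContinuousAt.sub (ContinuousAt.mul (by fun_prop) (continuousAt_const.add
      (continuousAt_const.mul (tendsto_finsetSum _ fun j hj => ?_)))) (continuousAt_const.mul
      (ContinuousAt.div continuousAt_const (by fun_prop) (p.add_ne_zero hk' k)))
    refine ContinuousAt.div continuousAt_const (by fun_prop) (mul_ne_zero (p.add_ne_zero hk' j) ?_)
    exact ofReal_ne_neg_of_pos fun h => (mem_erase.1 hj).1 (p.ε_injective h).symm
  have hψ : ∀ z : ℂ, 0 < z.re → z ≠ ε k → (z - ε k) * 𝒦 z (-z) = ψ z := fun z hz hzk => by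
    have h1 := p.add_ne_zero hz k
    have h2 : (ε k : ℂ) + -z ≠ 0 := fun h => hzk (by linear_combination -h)
    have h3 : (z - ε k) * ((ϱ k : ℂ) / (((ε k : ℂ) + z) * ((ε k : ℂ) + -z)))
        = -((ϱ k : ℂ) / ((ε k : ℂ) + z)) := by
      field_simp
      ring
    simp only [ψ, dividedR]
    rw [← Finset.add_sum_erase univ _ (mem_univ k)]
    linear_combination (lam / N : ℂ) * h3
  -- both sides of the polynomial identity times `R(z) - R(εₖ)`, in the limit `z → εₖ`
  have key : lam * ((ℛ (ε k : ℂ) - ℛ w) * L.eval (ℛ (ε k : ℂ)))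
      = (∏ j ∈ univ.erase k, (ℛ (ε k : ℂ) - ℛ (ε j : ℂ))) *
        ((ℛ (ε k : ℂ) - ℛ w) * (𝒦 (ε k) (ε k) * (2 * ε k * ψ (ε k))) *
          onePlusOne lam N ε ϱ α (ε k) w - lam * ((ℛ (ε k : ℂ) - ℛ (ε k : ℂ)) *
          (twoPoint lam N ε ϱ (ε k) w - twoPoint lam N ε ϱ w w))) := by
    refine eq_of_eventuallyEq_punctured (f := fun z => lam * ((ℛ z - ℛ w) * L.eval (ℛ z)))
      (g := fun z => (∏ j ∈ univ.erase k, (ℛ z - ℛ (ε j : ℂ))) *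
        ((ℛ z - ℛ w) * (𝒦 (ε k) z * (2 * z * ψ z)) * onePlusOne lam N ε ϱ α z w
          - lam * ((ℛ z - ℛ (ε k : ℂ)) * (twoPoint lam N ε ϱ z w - twoPoint lam N ε ϱ w w))))
      ?_ ?_ ?_
    · exact continuousAt_const.mul ((hR.sub continuousAt_const).mul
        (L.continuous.continuousAt.comp hR))
    · refine ContinuousAt.mul (tendsto_finsetProd _ fun j _ => hR.sub continuousAt_const) ?_
      refine ContinuousAt.sub (((hR.sub continuousAt_const).mul
        ((differentiableAt_dividedR_right p hk' hk').continuousAt.mul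
          ((continuousAt_const.mul continuousAt_id).mul hψc))).mul
          (hV.continuousAt_onePlusOne_left p hk hw)) ?_
      exact continuousAt_const.mul ((hR.sub continuousAt_const).mul
        ((hV.continuousAt_twoPoint_left p hk hw).sub continuousAt_const))
    · filter_upwards [nhdsWithin_le_nhds (hV.isOpen.mem_nhds hk),
        Filter.eventually_all.2 fun j => eventually_punctured_ne (ε j : ℂ) (ε k : ℂ),
        eventually_punctured_ne w (ε k : ℂ)] with z hz hzε hzw
      have hz' := hV.re_pos z hz
      have h1 := hV.eval_equationNum p hz hw hzε
      have h2 := hV.sq_mul_onePlusOne p hz hw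
      rw [hL, ← Finset.mul_prod_erase univ _ (mem_univ k)] at h1
      simp only [eval_mul, eval_sub, eval_X, eval_C] at h1
      have h3 := R_sub_R (ε := ε) lam N ϱ (p.add_ne_zero hz') (p.add_ne_zero hk')
      rw [dividedR_comm] at h3
      have h4 := R_sub_R_neg p hz' hzε
      rw [← hψ z hz' (hzε k)]
      refine mul_left_cancel₀ (hV.R_sub_R_ne_zero hz hw hzw) ?_
      rw [h4] at h1
      rw [h3] at h1 ⊢
      linear_combination lam * h1 - (∏ j ∈ univ.erase k, (ℛ z - ℛ (ε j : ℂ))) *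
        ((z - ε k) * 𝒦 (ε k) z) * (2 * z * 𝒦 z (-z)) * h2
  have hψk : 2 * ε k * ψ (ε k) = -((lam / N : ℂ) * ϱ k) := by
    have h0 : (ε k : ℂ) ≠ 0 := Complex.ofReal_ne_zero.2 (p.ε_pos k).ne'
    simp only [ψ, sub_self, zero_mul, zero_sub, ← two_mul]
    field_simp
  rw [hψk] at key
  refine mul_left_cancel₀ hkw ?_
  linear_combination key

/-- The affine equation as the partial fraction expansion in `t = R(z)` of the quotient of
`equationNum` by `(t - R(w))² ∏ₖ (t - R(εₖ))`. -/
lemma onePlusOne_equation_of_ne {z w : ℂ} (hz : z ∈ V) (hw : w ∈ V) (hzw : z ≠ w)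
    (hzε : ∀ k, z ≠ (ε k : ℂ)) (hwε : ∀ k, w ≠ (ε k : ℂ)) :
    (ℛ z - ℛ (-z)) * onePlusOne lam N ε ϱ α z w - (lam / N : ℂ) *
        ∑ k, ((ϱ k : ℂ) * 𝒦 (ε k) (ε k)) * onePlusOne lam N ε ϱ α (ε k) w /
          (ℛ (ε k : ℂ) - ℛ z)
      = lam * ((twoPoint lam N ε ϱ z w - twoPoint lam N ε ϱ w w) / (ℛ z - ℛ w)) := by
  obtain ⟨L, hdeg, hL⟩ := hV.exists_equationNum_eq p hw hwε
  have hinj : Function.Injective fun k => ℛ (ε k : ℂ) := fun i j hij =>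
    p.ε_injective (Complex.ofReal_injective (hV.injOn (hV.ε_mem p i) (hV.ε_mem p j) hij))
  have hnum : C (lam : ℂ) * L = partialFractionNum (fun k => ℛ (ε k : ℂ)) fun k =>
      -((lam / N : ℂ) * (ϱ k * 𝒦 (ε k) (ε k)) * onePlusOne lam N ε ϱ α (ε k) w) := by
    refine eq_of_eval_eq_of_degree_lt hinj ?_ (degree_partialFractionNum_lt _ _) fun k => ?_
    · rw [← smul_eq_C_mul]
      exact (degree_smul_le _ _).trans_lt hdeg
    · rw [eval_mul, eval_C, hV.eval_residue p hw hwε hL]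
      exact (eval_partialFractionNum_node (fun k => ℛ (ε k : ℂ)) (fun k => -((lam / N : ℂ) *
        (ϱ k * 𝒦 (ε k) (ε k)) * onePlusOne lam N ε ϱ α (ε k) w)) k).symm
  have hne : ∀ k, ℛ z - ℛ (ε k : ℂ) ≠ 0 := fun k =>
    hV.R_sub_R_ne_zero hz (hV.ε_mem p k) (hzε k)
  have heval := congrArg (eval (ℛ z)) hnum
  rw [eval_partialFractionNum _ _ hne, eval_mul, eval_C] at heval
  have h1 := hV.eval_equationNum p hz hw hzε
  have h2 := hV.sq_mul_onePlusOne p hz hw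
  rw [hL] at h1
  simp only [eval_mul, eval_sub, eval_X, eval_C] at h1
  have hsum : ∑ k, -((lam / N : ℂ) * (ϱ k * 𝒦 (ε k) (ε k)) * onePlusOne lam N ε ϱ α (ε k) w) /
        (ℛ z - ℛ (ε k : ℂ))
      = (lam / N : ℂ) * ∑ k, ((ϱ k : ℂ) * 𝒦 (ε k) (ε k)) * onePlusOne lam N ε ϱ α (ε k) w /
          (ℛ (ε k : ℂ) - ℛ z) := by
    rw [Finset.mul_sum]
    refine Finset.sum_congr rfl fun k _ => ?_
    rw [← neg_sub (ℛ z), div_neg, neg_div]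
    ring
  rw [hsum] at heval
  have hzw' := hV.R_sub_R_ne_zero hz hw hzw
  have hD : ∏ k, (ℛ z - ℛ (ε k : ℂ)) ≠ 0 := Finset.prod_ne_zero_iff.2 fun k _ => hne k
  rw [← mul_div_assoc, eq_div_iff hzw']
  refine mul_left_cancel₀ (mul_ne_zero hD hzw') ?_
  linear_combination (∏ k, (ℛ z - ℛ (ε k : ℂ))) * (ℛ z - ℛ (-z)) * h2 - lam * h1 +
    (ℛ z - ℛ w) ^ 2 * heval

/-- The affine equation; the points `w = εₖ`, where `R(-w)` has a pole, follow by continuity in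
`w`. -/
lemma onePlusOne_equation {z w : ℂ} (hz : z ∈ V) (hw : w ∈ V) (hzw : z ≠ w)
    (hzε : ∀ k, z ≠ (ε k : ℂ)) :
    (ℛ z - ℛ (-z)) * onePlusOne lam N ε ϱ α z w - (lam / N : ℂ) *
        ∑ k, ((ϱ k : ℂ) * 𝒦 (ε k) (ε k)) * onePlusOne lam N ε ϱ α (ε k) w /
          (ℛ (ε k : ℂ) - ℛ z)
      = lam * ((twoPoint lam N ε ϱ z w - twoPoint lam N ε ϱ w w) / (ℛ z - ℛ w)) := by
  refine eq_of_eventuallyEq_punctured (w := w)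
    (f := fun w => (ℛ z - ℛ (-z)) * onePlusOne lam N ε ϱ α z w - (lam / N : ℂ) *
        ∑ k, ((ϱ k : ℂ) * 𝒦 (ε k) (ε k)) * onePlusOne lam N ε ϱ α (ε k) w /
          (ℛ (ε k : ℂ) - ℛ z))
    (g := fun w => lam * ((twoPoint lam N ε ϱ z w - twoPoint lam N ε ϱ w w) / (ℛ z - ℛ w)))
    ?_ ?_ ?_
  · refine (continuousAt_const.mul (hV.continuousAt_onePlusOne_right p hz hw)).sub
      (continuousAt_const.mul (tendsto_finsetSum _ fun k _ => ContinuousAt.div_const ?_ _))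
    exact continuousAt_const.mul (hV.continuousAt_onePlusOne_right p (hV.ε_mem p k) hw)
  · exact continuousAt_const.mul (((hV.continuousAt_twoPoint_right p hz hw).sub
      (hV.continuousAt_twoPoint_self p hw)).div (continuousAt_const.sub
      (continuousAt_R p (hV.re_pos w hw))) (hV.R_sub_R_ne_zero hz hw hzw))
  · filter_upwards [nhdsWithin_le_nhds (hV.isOpen.mem_nhds hw),
      Filter.eventually_all.2 fun k => eventually_punctured_ne (ε k : ℂ) w,
      eventually_punctured_ne z w] with x hx hxε hxz
    exact hV.onePlusOne_equation_of_ne p hz hx hxz.symm hzε hxε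

omit hV in
lemma deriv_R_self {z : ℂ} (hz : 0 < z.re) : deriv ℛ z = 𝒦 z z := by
  have hcont := (differentiableAt_dividedR_right p hz hz).continuousAt
  refine HasDerivAt.deriv (hasDerivAt_iff_tendsto_slope.2
    ((hcont.tendsto.mono_left nhdsWithin_le_nhds).congr' ?_))
  have hU : IsOpen {z : ℂ | 0 < z.re} := isOpen_lt continuous_const Complex.continuous_re
  filter_upwards [nhdsWithin_le_nhds (hU.mem_nhds hz), self_mem_nhdsWithin] with x hx hxz
  rw [slope_def_field, R_sub_R lam N ϱ (p.add_ne_zero hx) (p.add_ne_zero hz),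
    mul_div_cancel_left₀ _ (sub_ne_zero.2 hxz), dividedR_comm]

lemma isOnePlusOnePoint_onePlusOne {r : Fin d → ℝ}
    (hr : ∀ k, (r k : ℂ) = (ϱ k : ℂ) * deriv ℛ (ε k : ℂ)) :
    IsOnePlusOnePoint lam N r ε ϱ V (onePlusOne lam N ε ϱ α) where
  regular _ hw := hV.differentiableOn_onePlusOne p hw
  equation z hz w hw hzw hzε := by
    simp only [hr, fun k => deriv_R_self p (p.ε_re_pos k)]
    exact hV.onePlusOne_equation p hz hw hzw hzε

/-! ### Uniqueness -/

/-- Regularity at `z = αₖ` forces `∑ₖ rₖ F(εₖ) / (R(αⱼ) - R(εₖ)) = 0` for all `j`, a Cauchy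
system with trivial kernel. -/
lemma eq_zero_of_homogeneous_equation (r : Fin d → ℝ) {F : ℂ → ℂ}
    (hF : DifferentiableOn ℂ F V) (w : ℂ)
    (h : ∀ z ∈ V, z ≠ w → (∀ k, z ≠ (ε k : ℂ)) →
      (ℛ z - ℛ (-z)) * F z
        = (lam / N : ℂ) * ∑ k, (r k : ℂ) * F (ε k) / (ℛ (ε k : ℂ) - ℛ z))
    {z : ℂ} (hz : z ∈ V) : F z = 0 := by
  have hFc : ∀ {x : ℂ}, x ∈ V → ContinuousAt F x := fun hx =>
    (hF.differentiableAt (hV.isOpen.mem_nhds hx)).continuousAt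
  have hαε : ∀ j k, (α j : ℂ) ≠ (ε k : ℂ) := fun j k h =>
    p.α_ne_ε j k (Complex.ofReal_injective h)
  have hinj : ∀ {a : Fin d → ℝ}, (∀ k, 0 < a k) → Function.Injective a →
      Function.Injective fun k => ℛ (a k : ℂ) := fun ha hinj i j hij =>
    hinj (Complex.ofReal_injective
      (hV.injOn (hV.ofReal_mem _ (ha i)) (hV.ofReal_mem _ (ha j)) hij))
  have hcauchy : ∀ j, ∑ k, ((r k : ℂ) * F (ε k)) / (ℛ (α j : ℂ) - ℛ (ε k : ℂ)) = 0 := by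
    intro j
    have hα := hV.α_mem p j
    have hR := continuousAt_R p (p.α_re_pos j)
    have h1 : (ℛ (α j : ℂ) - ℛ (-(α j : ℂ))) * F (α j)
        = (lam / N : ℂ) * ∑ k, (r k : ℂ) * F (ε k) / (ℛ (ε k : ℂ) - ℛ (α j : ℂ)) := by
      refine eq_of_eventuallyEq_punctured (w := (α j : ℂ))
        (f := fun z => (ℛ z - ℛ (-z)) * F z)
        (g := fun z => (lam / N : ℂ) * ∑ k, (r k : ℂ) * F (ε k) / (ℛ (ε k : ℂ) - ℛ z))
        ((hR.sub (continuousAt_R_neg (hαε j))).mul (hFc hα))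
        (continuousAt_const.mul (tendsto_finsetSum _ fun k _ => continuousAt_const.div
          (continuousAt_const.sub hR)
          (hV.R_sub_R_ne_zero (hV.ε_mem p k) hα (hαε j k).symm))) ?_
      filter_upwards [nhdsWithin_le_nhds (hV.isOpen.mem_nhds hα),
        Filter.eventually_all.2 fun k => eventually_punctured_ne (ε k : ℂ) (α j : ℂ),
        eventually_punctured_ne w (α j : ℂ)] with x hx hxε hxw
      exact h x hx hxw hxε
    rw [p.R_α j, sub_self, zero_mul, ← p.R_α j] at h1
    have h2 := (mul_eq_zero.1 h1.symm).resolve_left p.coupling_ne_zero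
    rw [← neg_eq_zero, ← Finset.sum_neg_distrib, ← h2]
    refine Finset.sum_congr rfl fun k _ => ?_
    rw [← neg_sub (ℛ (ε k : ℂ)), div_neg, neg_neg]
  have hFε : ∀ k, (r k : ℂ) * F (ε k) = 0 :=
    eq_zero_of_sum_div_eq_zero (hinj p.ε_pos p.ε_injective) (hinj p.α_pos p.α_injective)
      (fun j k => hV.R_sub_R_ne_zero (hV.α_mem p j) (hV.ε_mem p k) (hαε j k)) hcauchy
  refine eq_of_eventuallyEq_punctured (g := fun _ => 0) (hFc hz) continuousAt_const ?_
  filter_upwards [nhdsWithin_le_nhds (hV.isOpen.mem_nhds hz),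
    Filter.eventually_all.2 fun k => eventually_punctured_ne (ε k : ℂ) z,
    Filter.eventually_all.2 fun k => eventually_punctured_ne (α k : ℂ) z,
    eventually_punctured_ne w z] with x hx hxε hxα hxw
  have h1 := h x hx hxw hxε
  simp only [hFε, zero_div, Finset.sum_const_zero, mul_zero] at h1
  exact (mul_eq_zero.1 h1).resolve_left (hV.R_sub_R_neg_ne_zero p hx hxε hxα)

lemma eq_onePlusOne {r : Fin d → ℝ}
    (hr : ∀ k, (r k : ℂ) = (ϱ k : ℂ) * deriv ℛ (ε k : ℂ)) {G : ℂ → ℂ → ℂ}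
    (hG : IsOnePlusOnePoint lam N r ε ϱ V G) {z w : ℂ} (hz : z ∈ V) (hw : w ∈ V) :
    G z w = onePlusOne lam N ε ϱ α z w := by
  have hG' := hV.isOnePlusOnePoint_onePlusOne p hr
  refine sub_eq_zero.1 (hV.eq_zero_of_homogeneous_equation p r
    (F := fun z => G z w - onePlusOne lam N ε ϱ α z w) ((hG.regular w hw).sub (hG'.regular w hw))
    w (fun x hx hxw hxε => ?_) hz)
  have h1 := hG.equation x hx w hw hxw hxε
  have h2 := hG'.equation x hx w hw hxw hxε
  simp only [mul_sub, sub_div, Finset.sum_sub_distrib]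
  linear_combination h1 - h2

lemma onePlusOne_eq {z w : ℂ} (hz : z ∈ V) (hw : w ∈ V) (hzw : z ≠ w)
    (h : ∀ k, z ≠ (ε k : ℂ) ∧ z ≠ (α k : ℂ) ∧ w ≠ (ε k : ℂ) ∧ w ≠ (α k : ℂ)) :
    onePlusOne lam N ε ϱ α z w = lam / (ℛ z - ℛ w) ^ 2 * (twoPoint lam N ε ϱ z w
      - (ℛ z + ℛ w - 2 * ℛ 0) / ((ℛ z - ℛ (-z)) * (ℛ w - ℛ (-w))) *
        ∏ k, ((ℛ z - ℛ (α k : ℂ)) * (ℛ w - ℛ (α k : ℂ))) /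
          ((ℛ z - ℛ (ε k : ℂ)) * (ℛ w - ℛ (ε k : ℂ)))) := by
  have hT : ∀ {x : ℂ}, x ∈ V → (∀ k, x ≠ (ε k : ℂ)) → (∀ k, x ≠ (α k : ℂ)) →
      𝒯 x = (∏ k, (ℛ x - ℛ (α k : ℂ))) / ((ℛ x - ℛ (-x)) * ∏ k, (ℛ x - ℛ (ε k : ℂ))) :=
    fun hx hxε hxα => by
      rw [eq_div_iff (mul_ne_zero (hV.R_sub_R_neg_ne_zero p hx hxε hxα)
        (Finset.prod_ne_zero_iff.2 fun k _ => hV.R_sub_R_ne_zero hx (hV.ε_mem p k) (hxε k))),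
        ← hV.diagFactor_mul p hx hxε]
      ring
  rw [div_mul_eq_mul_div, eq_div_iff (pow_ne_zero 2 (hV.R_sub_R_ne_zero hz hw hzw)), mul_comm,
    hV.sq_mul_onePlusOne p hz hw, defect, hT hz (fun k => (h k).1) (fun k => (h k).2.1),
    hT hw (fun k => (h k).2.2.1) (fun k => (h k).2.2.2), Finset.prod_div_distrib,
    Finset.prod_mul_distrib, Finset.prod_mul_distrib]
  simp only [div_eq_mul_inv, mul_inv]
  ring

end Region

end QuarticKontsevich

theorem mainTheorem2 {d : ℕ} (lam N : ℝ) (E r ε ϱ α : Fin d → ℝ) (V : Set ℂ)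
    (hlam : 0 < lam) (hN : 0 < N)
    (hE : ∀ k, 0 < E k) (hEinj : Function.Injective E) (hr : ∀ k, 0 < r k)
    (hε : ∀ k, 0 < ε k) (hϱ : ∀ k, 0 < ϱ k)
    (hRE : ∀ k, QuarticKontsevich.R lam N ε ϱ (ε k : ℂ) = (E k : ℂ))
    (hRr : ∀ k, (r k : ℂ) = (ϱ k : ℂ) * deriv (QuarticKontsevich.R lam N ε ϱ) (ε k : ℂ))
    (hα : ∀ k, 0 < α k) (hαinj : Function.Injective α) (hαε : ∀ k j, α k ≠ ε j)
    (hαroot : ∀ k, QuarticKontsevich.R lam N ε ϱ (α k : ℂ)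
      = QuarticKontsevich.R lam N ε ϱ (-(α k : ℂ)))
    (hVopen : IsOpen V) (hVpos : ∀ x : ℝ, 0 < x → (x : ℂ) ∈ V) (hVre : ∀ z ∈ V, 0 < z.re)
    (hVinj : Set.InjOn (QuarticKontsevich.R lam N ε ϱ) V) :
    (∃ G : ℂ → ℂ → ℂ, QuarticKontsevich.IsOnePlusOnePoint lam N r ε ϱ V G) ∧
    ∀ G : ℂ → ℂ → ℂ, QuarticKontsevich.IsOnePlusOnePoint lam N r ε ϱ V G →
      (∀ z ∈ V, ∀ w ∈ V, G z w = G w z) ∧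
      ∀ z ∈ V, ∀ w ∈ V, z ≠ w →
        (∀ k, z ≠ (ε k : ℂ) ∧ z ≠ (α k : ℂ) ∧ w ≠ (ε k : ℂ) ∧ w ≠ (α k : ℂ)) →
        G z w = (lam : ℂ) /
            (QuarticKontsevich.R lam N ε ϱ z - QuarticKontsevich.R lam N ε ϱ w) ^ 2 *
          (QuarticKontsevich.twoPoint lam N ε ϱ z w
            - (QuarticKontsevich.R lam N ε ϱ z + QuarticKontsevich.R lam N ε ϱ w
                - 2 * QuarticKontsevich.R lam N ε ϱ 0) /
              ((QuarticKontsevich.R lam N ε ϱ z - QuarticKontsevich.R lam N ε ϱ (-z)) *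
                (QuarticKontsevich.R lam N ε ϱ w - QuarticKontsevich.R lam N ε ϱ (-w))) *
              ∏ k, ((QuarticKontsevich.R lam N ε ϱ z - QuarticKontsevich.R lam N ε ϱ (α k : ℂ)) *
                  (QuarticKontsevich.R lam N ε ϱ w - QuarticKontsevich.R lam N ε ϱ (α k : ℂ))) /
                ((QuarticKontsevich.R lam N ε ϱ z - QuarticKontsevich.R lam N ε ϱ (ε k : ℂ)) *
                  (QuarticKontsevich.R lam N ε ϱ w
                    - QuarticKontsevich.R lam N ε ϱ (ε k : ℂ)))) := by
  have p : QuarticKontsevich.Parameters lam N ε ϱ α :=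
    { lam_pos := hlam
      N_pos := hN
      ε_pos := hε
      ε_injective := fun i j hij => hEinj (Complex.ofReal_injective (by rw [← hRE, ← hRE, hij]))
      ϱ_pos := hϱ
      α_pos := hα
      α_injective := hαinj
      α_ne_ε := hαε
      R_α := hαroot }
  have hV : QuarticKontsevich.Region lam N ε ϱ V := ⟨hVopen, hVpos, hVre, hVinj⟩
  refine ⟨⟨_, hV.isOnePlusOnePoint_onePlusOne p hRr⟩, fun G hG => ⟨fun z hz w hw => ?_,
    fun z hz w hw hzw h => ?_⟩⟩
  · rw [hV.eq_onePlusOne p hRr hG hz hw, hV.eq_onePlusOne p hRr hG hw hz,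
      hV.onePlusOne_comm p hz hw]
  · rw [hV.eq_onePlusOne p hRr hG hz hw]
    exact hV.onePlusOne_eq p hz hw hzw h
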